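/- **Theorem 5.1.** Let $G=P2/m$ be the tenth crystallographic space group, i.e. the group with generators $x,y,z,r,m$ and defining relations $$[x,y]=[x,z]=[y,z]=1,\quad r^2=m^2=(mr)^2=1,$$ $$x^m=x,\quad y^m=y^{-1},\quad z^m=z,\quad x^r=x^{-1},\quad y^r=y,\quad z^r=z^{-1},$$ where $a^b=b^{-1}ab$. For every integer $n\ge 1$ the number $a_n$ of all subgroups of index $n$ in $G$ is finite, and, as the real variable $x\to\infty$, $$\sum_{1\le n\le x} a_n=\frac{\pi^2}{384}\,\zeta(3)\,x^4+O(x^3\ln x),$$ where $\zeta$ is the Riemann zeta function. -/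

import Mathlib

/-- The five generators of the crystallographic group `P2/m`: three translations `x, y, z`,
the diad rotation `r` and the reflection `m`. -/
inductive P2mGen : Type
  | x | y | z | r | m

namespace P2mGen

open scoped commutatorElement

/-- The conjugate `a ^ b = b⁻¹ a b` of `a` by `b`. -/
def conjBy {G : Type*} [Group G] (a b : G) : G := b⁻¹ * a * b

/-- A generator as an element of the free group. -/
def gen (g : P2mGen) : FreeGroup P2mGen := FreeGroup.of g

/-- The defining relators of `P2/m`; a relation `u = v` is encoded as the relator `u * v⁻¹`. -/
def rels : Set (FreeGroup P2mGen) :=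
  { ⁅gen x, gen y⁆, ⁅gen x, gen z⁆, ⁅gen y, gen z⁆,
    gen r ^ 2, gen m ^ 2, (gen m * gen r) ^ 2,
    conjBy (gen x) (gen m) * (gen x)⁻¹,
    conjBy (gen y) (gen m) * ((gen y)⁻¹)⁻¹,
    conjBy (gen z) (gen m) * (gen z)⁻¹,
    conjBy (gen x) (gen r) * ((gen x)⁻¹)⁻¹,
    conjBy (gen y) (gen r) * (gen y)⁻¹,
    conjBy (gen z) (gen r) * ((gen z)⁻¹)⁻¹ }

end P2mGen

/-- The space group `P2/m`, given by generators and relations. -/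
abbrev GroupP2m : Type := PresentedGroup P2mGen.rels

/-- The number of subgroups of index `n` in `G`. It is meant for `n ≥ 1` only: in Mathlib the index
of a subgroup of infinite index is `0`. -/
noncomputable def numSubgroupsOfIndex (G : Type*) [Group G] (n : ℕ) : ℕ :=
  {H : Subgroup G | H.index = n}.ncard

/-! The group is ℤ³ ⋊ {±1}², one sign acting on the y-axis and the other on the xz-plane. A subgroup
H is determined by its lattice L = H ∩ ℤ³, its point group P, and one coset of L for each element of
P; moreover 4[ℤ³ : L] = |P| [G : H] (`index_lattice_mul`).

The main term comes from P = {1, -1}. Inversion preserves every L and puts no condition on the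
coset, so each L of index k gives exactly k subgroups, of index 2k (`card_central`). Hermite normal
form counts the lattices: Σ_{j∣k} j σ(j) of them have index k (`card_ofIndex_transLattice`).
Multiplying by k gives the Dirichlet series ζ(s-1)ζ(s-2)ζ(s-3), that is, the convolution `pow 1 *
(pow 2 * pow 3)`. Its sum up to y is ζ(2)ζ(3)y⁴/4 + O(y³ log y), and y = x/2 yields the constant
π²ζ(3)/384.

All other subgroups contribute O(x³). A trivial point group gives one subgroup per lattice. If P
contains the reflection or the rotation, L is stable under y ↦ -y; this makes the Hermite coset
2-torsion, so at most 4 Σ_{j∣k} σ(j) lattices of index k qualify, and each carries at most 10k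
subgroups (`ncard_noncentral_le`). -/

/-- The translation lattice `ℤ³` with coordinates ordered as `(y, (x, z))`. -/
abbrev TransLattice : Type := ℤ × (ℤ × ℤ)

/-- The signs by which a point operation of `P2/m` acts on the `y`-axis and on the `xz`-plane. -/
abbrev PointSign : Type := ℤˣ × ℤˣ

/-- The group of affine maps `v ↦ sign • v + trans`. -/
@[ext]
structure AffineP2m where
  trans : TransLattice
  sign : PointSign

/-! ### The concrete model ℤ³ ⋊ {±1}² -/

namespace AffineP2m

/-- The linear action of the point group on the translation lattice. -/
def act (g : PointSign) (v : TransLattice) : TransLattice := (g.1 • v.1, g.2 • v.2)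

@[simp] lemma act_fst (g : PointSign) (v : TransLattice) : (act g v).1 = g.1 • v.1 := rfl
@[simp] lemma act_snd (g : PointSign) (v : TransLattice) : (act g v).2 = g.2 • v.2 := rfl

lemma act_add (g : PointSign) (v w : TransLattice) : act g (v + w) = act g v + act g w := by
  simp [act]

lemma act_mul (g h : PointSign) (v : TransLattice) : act (g * h) v = act g (act h v) := by
  simp [act, mul_smul]

@[simp] lemma act_one (v : TransLattice) : act 1 v = v := by simp [act]

@[simp] lemma act_zero (g : PointSign) : act g 0 = 0 := by simp [act]

instance : Mul AffineP2m := ⟨fun a b => ⟨a.trans + act a.sign b.trans, a.sign * b.sign⟩⟩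
instance : One AffineP2m := ⟨⟨0, 1⟩⟩
instance : Inv AffineP2m := ⟨fun a => ⟨-act a.sign⁻¹ a.trans, a.sign⁻¹⟩⟩

@[simp] lemma mul_trans (a b : AffineP2m) : (a * b).trans = a.trans + act a.sign b.trans := rfl
@[simp] lemma mul_sign (a b : AffineP2m) : (a * b).sign = a.sign * b.sign := rfl
@[simp] lemma one_trans : (1 : AffineP2m).trans = 0 := rfl
@[simp] lemma one_sign : (1 : AffineP2m).sign = 1 := rfl
@[simp] lemma inv_trans (a : AffineP2m) : (a⁻¹).trans = -act a.sign⁻¹ a.trans := rfl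
@[simp] lemma inv_sign (a : AffineP2m) : (a⁻¹).sign = a.sign⁻¹ := rfl

instance : Group AffineP2m :=
  Group.ofLeftAxioms
    (fun a b c => AffineP2m.ext (by simp only [mul_trans, mul_sign, act_add, act_mul, add_assoc])
      (mul_assoc _ _ _))
    (fun a => AffineP2m.ext (by simp) (one_mul _))
    (fun a => AffineP2m.ext (by simp) (inv_mul_cancel _))

/-- The inclusion of the translations. -/
def transHom : Multiplicative TransLattice →* AffineP2m where
  toFun v := ⟨v.toAdd, 1⟩
  map_one' := rfl
  map_mul' v w := AffineP2m.ext (by simp) rfl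

/-- The projection to the point group. -/
def signHom : AffineP2m →* PointSign where
  toFun := sign
  map_one' := rfl
  map_mul' _ _ := rfl

/-- The images of the generators of `P2/m`. -/
def ofGen : P2mGen → AffineP2m
  | .x => ⟨(0, 1, 0), 1⟩
  | .y => ⟨(1, 0, 0), 1⟩
  | .z => ⟨(0, 0, 1), 1⟩
  | .r => ⟨0, (1, -1)⟩
  | .m => ⟨0, (-1, 1)⟩

lemma ofGen_rels : ∀ w ∈ P2mGen.rels, FreeGroup.lift ofGen w = 1 := by
  intro w hw
  simp only [P2mGen.rels, Set.mem_insert_iff, Set.mem_singleton_iff] at hw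
  rcases hw with h | h | h | h | h | h | h | h | h | h | h | h <;> subst h <;>
    simp only [P2mGen.conjBy, P2mGen.gen, map_mul, map_inv,
      FreeGroup.lift_apply_of, commutatorElement_def, pow_two] <;>
    ext <;> simp [ofGen]

/-- The homomorphism from the presented group. -/
def ofPresented : GroupP2m →* AffineP2m := PresentedGroup.toGroup ofGen_rels

end AffineP2m

/-! ### Normal forms in the presented group -/

namespace GroupP2m

/-- A generator as an element of `P2/m`. -/
abbrev gen (g : P2mGen) : GroupP2m := PresentedGroup.of g

lemma mk_eq_one {w : FreeGroup P2mGen} (hw : w ∈ P2mGen.rels) :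
    PresentedGroup.mk P2mGen.rels w = 1 :=
  PresentedGroup.one_of_mem hw

section Relations

open P2mGen
open scoped commutatorElement

lemma commute_xy : Commute (gen x) (gen y) :=
  commutatorElement_eq_one_iff_commute.1
    (mk_eq_one (w := ⁅P2mGen.gen x, P2mGen.gen y⁆) (by simp [rels]))

lemma commute_xz : Commute (gen x) (gen z) :=
  commutatorElement_eq_one_iff_commute.1
    (mk_eq_one (w := ⁅P2mGen.gen x, P2mGen.gen z⁆) (by simp [rels]))

lemma commute_yz : Commute (gen y) (gen z) :=
  commutatorElement_eq_one_iff_commute.1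
    (mk_eq_one (w := ⁅P2mGen.gen y, P2mGen.gen z⁆) (by simp [rels]))

lemma r_sq : gen r ^ 2 = 1 := mk_eq_one (w := P2mGen.gen r ^ 2) (by simp [rels])

lemma m_sq : gen m ^ 2 = 1 := mk_eq_one (w := P2mGen.gen m ^ 2) (by simp [rels])

/-- The exponent e = ±1 treats the relations that fix a translation and those that invert it
together. -/
lemma semiconjBy_of_conjBy {g h k : P2mGen} {e : ℤ}
    (hw : conjBy (P2mGen.gen h) (P2mGen.gen g) * (P2mGen.gen k ^ e)⁻¹ ∈ rels) :
    SemiconjBy (gen g) (gen k ^ e) (gen h) := by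
  have h1 : (gen g)⁻¹ * gen h * gen g * (gen k ^ e)⁻¹ = 1 := mk_eq_one hw
  have h2 := mul_inv_eq_one.1 h1
  rw [SemiconjBy, ← h2]
  group

lemma commute_mx : Commute (gen m) (gen x) := by
  rw [Commute]
  simpa using semiconjBy_of_conjBy (g := m) (h := x) (k := x) (e := 1) (by simp [rels])

lemma commute_mz : Commute (gen m) (gen z) := by
  rw [Commute]
  simpa using semiconjBy_of_conjBy (g := m) (h := z) (k := z) (e := 1) (by simp [rels])

lemma commute_ry : Commute (gen r) (gen y) := by
  rw [Commute]
  simpa using semiconjBy_of_conjBy (g := r) (h := y) (k := y) (e := 1) (by simp [rels])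

lemma semiconjBy_my : SemiconjBy (gen m) (gen y)⁻¹ (gen y) := by
  simpa using semiconjBy_of_conjBy (g := m) (h := y) (k := y) (e := -1) (by simp [rels])

lemma semiconjBy_rx : SemiconjBy (gen r) (gen x)⁻¹ (gen x) := by
  simpa using semiconjBy_of_conjBy (g := r) (h := x) (k := x) (e := -1) (by simp [rels])

lemma semiconjBy_rz : SemiconjBy (gen r) (gen z)⁻¹ (gen z) := by
  simpa using semiconjBy_of_conjBy (g := r) (h := z) (k := z) (e := -1) (by simp [rels])

lemma commute_mr : Commute (gen m) (gen r) := by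
  have h : (gen m * gen r) ^ 2 = 1 :=
    mk_eq_one (w := (P2mGen.gen m * P2mGen.gen r) ^ 2) (by simp [rels])
  have hr : (gen r)⁻¹ = gen r := inv_eq_of_mul_eq_one_left (by simpa [pow_two] using r_sq)
  have hm : (gen m)⁻¹ = gen m := inv_eq_of_mul_eq_one_left (by simpa [pow_two] using m_sq)
  have h3 := inv_eq_of_mul_eq_one_left (by simpa [pow_two] using h)
  rw [mul_inv_rev, hr, hm] at h3
  exact h3.symm

/-- Words in normal form. -/
def word (a b c i j : ℤ) : GroupP2m :=
  gen y ^ a * gen x ^ b * gen z ^ c * gen r ^ i * gen m ^ j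

lemma y_mul_word (e a b c i j : ℤ) : gen y ^ e * word a b c i j = word (e + a) b c i j := by
  simp only [word, zpow_add, mul_assoc]

lemma x_mul_word (e a b c i j : ℤ) : gen x ^ e * word a b c i j = word a (e + b) c i j := by
  simp only [word, zpow_add, ← mul_assoc, (commute_xy.zpow_zpow e a).eq]

lemma z_mul_word (e a b c i j : ℤ) : gen z ^ e * word a b c i j = word a b (e + c) i j := by
  simp only [word, zpow_add, ← mul_assoc, (commute_yz.symm.zpow_zpow e a).eq]
  simp only [mul_assoc _ (gen z ^ e) (gen x ^ b), (commute_xz.symm.zpow_zpow e b).eq, ← mul_assoc]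

lemma r_mul_word (a b c i j : ℤ) : gen r * word a b c i j = word a (-b) (-c) (1 + i) j := by
  have h1 : gen r * gen y ^ a = gen y ^ a * gen r := (commute_ry.zpow_right a).eq
  have h2 : gen r * gen x ^ b = gen x ^ (-b) * gen r := by
    have := (semiconjBy_rx.zpow_right (-b)).eq
    rwa [inv_zpow', neg_neg] at this
  have h3 : gen r * gen z ^ c = gen z ^ (-c) * gen r := by
    have := (semiconjBy_rz.zpow_right (-c)).eq
    rwa [inv_zpow', neg_neg] at this
  simp only [word, ← mul_assoc, h1]
  simp only [mul_assoc _ (gen r) (gen x ^ b), h2, ← mul_assoc]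
  simp only [mul_assoc _ (gen r) (gen z ^ c), h3, ← mul_assoc, zpow_add, zpow_one]

lemma m_mul_word (a b c i j : ℤ) : gen m * word a b c i j = word (-a) b c i (1 + j) := by
  have h1 : gen m * gen y ^ a = gen y ^ (-a) * gen m := by
    have := (semiconjBy_my.zpow_right (-a)).eq
    rwa [inv_zpow', neg_neg] at this
  have h2 : gen m * gen x ^ b = gen x ^ b * gen m := (commute_mx.zpow_right b).eq
  have h3 : gen m * gen z ^ c = gen z ^ c * gen m := (commute_mz.zpow_right c).eq
  have h4 : gen m * gen r ^ i = gen r ^ i * gen m := (commute_mr.zpow_right i).eq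
  simp only [word, ← mul_assoc, h1]
  simp only [mul_assoc _ (gen m) (gen x ^ b), h2, ← mul_assoc]
  simp only [mul_assoc _ (gen m) (gen z ^ c), h3, ← mul_assoc]
  simp only [mul_assoc _ (gen m) (gen r ^ i), h4, ← mul_assoc, zpow_add, zpow_one]

/-- Left multiplication by a generator or its inverse keeps the normal form; r and m are their own
inverses. -/
lemma exists_word (g : GroupP2m) : ∃ a b c i j, g = word a b c i j := by
  have hg : g ∈ Subgroup.closure (Set.range (PresentedGroup.of (rels := rels))) := by
    rw [PresentedGroup.closure_range_of]; trivial
  have hr : (gen r)⁻¹ = gen r := inv_eq_of_mul_eq_one_left (by simpa [pow_two] using r_sq)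
  have hm : (gen m)⁻¹ = gen m := inv_eq_of_mul_eq_one_left (by simpa [pow_two] using m_sq)
  induction hg using Subgroup.closure_induction_left with
  | one => exact ⟨0, 0, 0, 0, 0, by simp [word]⟩
  | mul_left k hk h _ ih =>
    obtain ⟨k, rfl⟩ := hk
    obtain ⟨a, b, c, i, j, rfl⟩ := ih
    cases k with
    | x => exact ⟨_, _, _, _, _, by rw [← x_mul_word 1, zpow_one]⟩
    | y => exact ⟨_, _, _, _, _, by rw [← y_mul_word 1, zpow_one]⟩
    | z => exact ⟨_, _, _, _, _, by rw [← z_mul_word 1, zpow_one]⟩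
    | r => exact ⟨_, _, _, _, _, r_mul_word ..⟩
    | m => exact ⟨_, _, _, _, _, m_mul_word ..⟩
  | inv_mul_cancel k hk h _ ih =>
    obtain ⟨k, rfl⟩ := hk
    obtain ⟨a, b, c, i, j, rfl⟩ := ih
    cases k with
    | x => exact ⟨_, _, _, _, _, by rw [← x_mul_word (-1), zpow_neg_one]⟩
    | y => exact ⟨_, _, _, _, _, by rw [← y_mul_word (-1), zpow_neg_one]⟩
    | z => exact ⟨_, _, _, _, _, by rw [← z_mul_word (-1), zpow_neg_one]⟩
    | r => exact ⟨_, _, _, _, _, by rw [hr]; exact r_mul_word ..⟩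
    | m => exact ⟨_, _, _, _, _, by rw [hm]; exact m_mul_word ..⟩

end Relations

end GroupP2m

/-! ### The presented group is the concrete model -/

namespace AffineP2m

open GroupP2m

lemma ofPresented_gen (g : P2mGen) : ofPresented (gen g) = ofGen g :=
  PresentedGroup.toGroup.of ofGen_rels

lemma zpow_trans (v : TransLattice) (n : ℤ) : (⟨v, 1⟩ : AffineP2m) ^ n = ⟨n • v, 1⟩ :=
  (map_zpow transHom (Multiplicative.ofAdd v) n).symm

lemma zpow_sign (g : PointSign) (n : ℤ) : (⟨0, g⟩ : AffineP2m) ^ n = ⟨0, g ^ n⟩ :=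
  (map_zpow (⟨⟨fun g => ⟨0, g⟩, rfl⟩, fun g h => AffineP2m.ext (by simp) rfl⟩ :
    PointSign →* AffineP2m) g n).symm

lemma ofPresented_word (a b c i j : ℤ) :
    ofPresented (word a b c i j) = ⟨(a, b, c), ((-1) ^ j, (-1) ^ i)⟩ := by
  simp only [word, map_mul, map_zpow, ofPresented_gen, ofGen, zpow_trans, zpow_sign]
  ext <;> simp

/-- A word in normal form with trivial image has zero translation exponents and even exponents of r
and m, hence is trivial because r² = m² = 1. -/
lemma ofPresented_injective : Function.Injective ofPresented := by
  rw [injective_iff_map_eq_one]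
  intro g hg
  obtain ⟨a, b, c, i, j, rfl⟩ := exists_word g
  rw [ofPresented_word, AffineP2m.ext_iff] at hg
  simp only [one_trans, one_sign, Prod.mk_eq_zero, Prod.mk_eq_one] at hg
  obtain ⟨⟨rfl, rfl, rfl⟩, hj, hi⟩ := hg
  have even_of : ∀ n : ℤ, (-1 : ℤˣ) ^ n = 1 → Even n := by
    intro n hn
    by_contra h
    rw [Int.not_even_iff_odd] at h
    rw [h.neg_one_zpow] at hn
    exact absurd hn (by decide)
  obtain ⟨i, rfl⟩ := even_of i hi
  obtain ⟨j, rfl⟩ := even_of j hj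
  have hr : gen .r * gen .r = 1 := by simpa [pow_two] using r_sq
  have hm : gen .m * gen .m = 1 := by simpa [pow_two] using m_sq
  rw [word, zpow_add, zpow_add, ← (Commute.refl _).mul_zpow, ← (Commute.refl _).mul_zpow, hr, hm]
  simp

lemma ofPresented_surjective : Function.Surjective ofPresented := by
  rintro ⟨⟨a, b, c⟩, d, e⟩
  have h : ∀ u : ℤˣ, ∃ n : ℤ, (-1) ^ n = u := by
    intro u
    rcases Int.units_eq_one_or u with rfl | rfl
    · exact ⟨0, rfl⟩
    · exact ⟨1, rfl⟩
  obtain ⟨j, rfl⟩ := h d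
  obtain ⟨i, rfl⟩ := h e
  exact ⟨_, ofPresented_word a b c i j⟩

/-- `P2/m` is the concrete group of affine maps. -/
noncomputable def equivPresented : GroupP2m ≃* AffineP2m :=
  MulEquiv.ofBijective ofPresented ⟨ofPresented_injective, ofPresented_surjective⟩

end AffineP2m

/-! ### Hermite normal form for subgroups of ℤ × A -/

lemma AddSubgroup.index_eq_index_map_fst_mul {A : Type*} [AddCommGroup A]
    (L : AddSubgroup (ℤ × A)) :
    L.index = (L.map (AddMonoidHom.fst ℤ A)).index * (L.comap (AddMonoidHom.inr ℤ A)).index := by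
  have hker : (AddMonoidHom.fst ℤ A).ker = (AddMonoidHom.inr ℤ A).range := by
    ext v
    constructor
    · intro h
      exact ⟨v.2, Prod.ext (AddMonoidHom.mem_ker.1 h).symm rfl⟩
    · rintro ⟨a, rfl⟩
      rfl
  have hrange : (AddMonoidHom.fst ℤ A).range = ⊤ :=
    AddMonoidHom.range_eq_top.2 Prod.fst_surjective
  -- Use the chain L ≤ L + A ≤ ℤ × A with A the kernel of the projection: the lower index is [A : L
  -- ∩ A], the upper one is that of the projection of L.
  rw [AddSubgroup.index_map, hrange, AddSubgroup.index_top, mul_one, AddSubgroup.index_comap,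
    ← hker, ← AddSubgroup.relIndex_sup_left, mul_comm,
    AddSubgroup.relIndex_mul_index le_sup_left]

/-- The subgroup of `ℤ × A` generated by `(a, w)` and `L`. -/
def AddSubgroup.hermite {A : Type*} [AddCommGroup A] (a : ℤ) (L : AddSubgroup A) (w : A) :
    AddSubgroup (ℤ × A) where
  carrier := {v | ∃ n : ℤ, v.1 = n * a ∧ v.2 - n • w ∈ L}
  zero_mem' := ⟨0, by simp⟩
  add_mem' := by
    rintro v v' ⟨n, h1, h2⟩ ⟨n', h1', h2'⟩
    refine ⟨n + n', by simp [h1, h1', add_mul], ?_⟩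
    convert L.add_mem h2 h2' using 1
    simp only [Prod.snd_add, add_smul]; abel
  neg_mem' := by
    rintro v ⟨n, h1, h2⟩
    refine ⟨-n, by simp [h1], ?_⟩
    convert L.neg_mem h2 using 1
    simp only [Prod.snd_neg, neg_smul]; abel

namespace AddSubgroup

variable {A : Type*} [AddCommGroup A]

lemma mem_hermite {a : ℤ} {L : AddSubgroup A} {w : A} {v : ℤ × A} :
    v ∈ hermite a L w ↔ ∃ n : ℤ, v.1 = n * a ∧ v.2 - n • w ∈ L := Iff.rfl

lemma map_fst_hermite (a : ℤ) (L : AddSubgroup A) (w : A) :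
    (hermite a L w).map (AddMonoidHom.fst ℤ A) = zmultiples a := by
  ext t
  simp only [mem_map, mem_hermite, mem_zmultiples_iff, AddMonoidHom.coe_fst]
  constructor
  · rintro ⟨v, ⟨n, h, -⟩, rfl⟩
    exact ⟨n, by simp [h]⟩
  · rintro ⟨n, rfl⟩
    exact ⟨(n • a, n • w), ⟨n, by simp⟩, rfl⟩

lemma comap_inr_hermite {a : ℤ} (ha : a ≠ 0) (L : AddSubgroup A) (w : A) :
    (hermite a L w).comap (AddMonoidHom.inr ℤ A) = L := by
  ext t
  simp [mem_hermite, ha]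

lemma index_hermite {a : ℕ} (ha : a ≠ 0) (L : AddSubgroup A) (w : A) :
    (hermite a L w).index = a * L.index := by
  rw [index_eq_index_map_fst_mul, map_fst_hermite, comap_inr_hermite (by exact_mod_cast ha),
    Int.index_zmultiples, Int.natAbs_natCast]

lemma mem_hermite_self (a : ℤ) (L : AddSubgroup A) (w : A) : (a, w) ∈ hermite a L w :=
  ⟨1, by simp⟩

lemma pair_mem_hermite_iff {a : ℤ} (ha : a ≠ 0) {L : AddSubgroup A} {w w' : A} :
    (a, w') ∈ hermite a L w ↔ w' - w ∈ L := by
  rw [mem_hermite]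
  constructor
  · rintro ⟨n, h1, h2⟩
    have : n = 1 := by
      have h1 : a = n * a := h1
      exact (mul_right_cancel₀ ha (by simpa using h1)).symm
    simpa [this] using h2
  · exact fun h => ⟨1, by simp, by simpa using h⟩

lemma hermite_congr {a : ℤ} {L : AddSubgroup A} {w w' : A} (h : w' - w ∈ L) :
    hermite a L w = hermite a L w' := by
  ext v
  simp only [mem_hermite]
  refine exists_congr fun n => and_congr_right fun _ => ?_
  have e : v.2 - n • w = v.2 - n • w' + n • (w' - w) := by rw [smul_sub]; abel
  rw [e, L.add_mem_cancel_right (L.zsmul_mem h n)]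

/-- Subtracting a multiple of (a, w) moves any element of L into the fibre over 0. -/
lemma eq_hermite {a : ℤ} {L : AddSubgroup (ℤ × A)} {w : A}
    (ha : L.map (AddMonoidHom.fst ℤ A) = zmultiples a) (hw : (a, w) ∈ L) :
    L = hermite a (L.comap (AddMonoidHom.inr ℤ A)) w := by
  have key : ∀ (v : ℤ × A) (n : ℤ), v.1 = n * a →
      (v ∈ L ↔ v.2 - n • w ∈ L.comap (AddMonoidHom.inr ℤ A)) := by
    intro v n h
    have e : v = (0, v.2 - n • w) + n • (a, w) := by ext <;> simp [h]
    rw [mem_comap, AddMonoidHom.inr_apply]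
    conv_lhs => rw [e]
    exact L.add_mem_cancel_right (L.zsmul_mem hw n)
  ext v
  constructor
  · intro hv
    have : v.1 ∈ zmultiples a := ha ▸ mem_map_of_mem (AddMonoidHom.fst ℤ A) hv
    obtain ⟨n, hn⟩ := mem_zmultiples_iff.1 this
    have hn' : v.1 = n * a := by simp [← hn]
    exact ⟨n, hn', (key v n hn').1 hv⟩
  · rintro ⟨n, h1, h2⟩
    exact (key v n h1).2 h2

lemma exists_eq_hermite {L : AddSubgroup (ℤ × A)} (hL : L.index ≠ 0) :
    ∃ (a : ℕ) (w : A), a ≠ 0 ∧ L = hermite a (L.comap (AddMonoidHom.inr ℤ A)) w := by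
  obtain ⟨b, hb⟩ := Int.subgroup_cyclic (L.map (AddMonoidHom.fst ℤ A))
  rw [← zmultiples_eq_closure] at hb
  have hb' : L.map (AddMonoidHom.fst ℤ A) = zmultiples (b.natAbs : ℤ) := by
    rw [hb, Int.zmultiples_natAbs]
  have h0 : b.natAbs ≠ 0 := by
    rw [index_eq_index_map_fst_mul, hb, Int.index_zmultiples] at hL
    exact left_ne_zero_of_mul hL
  have hmem : (b.natAbs : ℤ) ∈ L.map (AddMonoidHom.fst ℤ A) := hb' ▸ mem_zmultiples _
  obtain ⟨⟨_, w⟩, hw, rfl⟩ := hmem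
  exact ⟨_, w, h0, eq_hermite hb' hw⟩

/-- The subgroups of index `k`. -/
abbrev OfIndex (A : Type*) [AddGroup A] (k : ℕ) : Type _ := {L : AddSubgroup A // L.index = k}

/-- The parameters of the subgroups of index `k` in `ℤ × A`. -/
abbrev HermiteData (A : Type*) [AddCommGroup A] (k : ℕ) : Type _ :=
  Σ j : k.divisors, Σ L : OfIndex A j, A ⧸ L.1

/-- The subgroup of `ℤ × A` with given parameters. -/
noncomputable def ofHermiteData {k : ℕ} (d : HermiteData A k) : OfIndex (ℤ × A) k :=
  ⟨hermite (k / d.1 : ℕ) d.2.1.1 d.2.2.out, by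
    have hd := Nat.mem_divisors.1 d.1.2
    rw [index_hermite (Nat.div_ne_zero_iff_of_dvd hd.1 |>.2 ⟨hd.2, fun h => hd.2 (by
      simpa [h] using hd.1)⟩), d.2.1.2, Nat.div_mul_cancel hd.1]⟩

lemma ofHermiteData_surjective {k : ℕ} (hk : k ≠ 0) :
    Function.Surjective (ofHermiteData (A := A) (k := k)) := by
  rintro ⟨L, rfl⟩
  obtain ⟨a, w, ha, hL⟩ := exists_eq_hermite hk
  set L' := L.comap (AddMonoidHom.inr ℤ A) with hL'
  have hidx : L.index = a * L'.index := by
    conv_lhs => rw [hL]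
    exact index_hermite ha L' w
  have hj : L'.index ≠ 0 := fun h => hk (by rw [hidx, h, mul_zero])
  refine ⟨⟨⟨L'.index, by simp [hidx, ha, hj]⟩, ⟨L', rfl⟩, (w : A ⧸ L')⟩, Subtype.ext ?_⟩
  have hdiv : L.index / L'.index = a := by
    rw [hidx, Nat.mul_div_cancel _ (Nat.pos_of_ne_zero hj)]
  change hermite ((L.index / L'.index : ℕ) : ℤ) L' (Quotient.out (w : A ⧸ L')) = L
  rw [hdiv]
  conv_rhs => rw [hL]
  refine hermite_congr ?_
  rw [← QuotientAddGroup.eq_iff_sub_mem]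
  exact (QuotientAddGroup.out_eq' _).symm

/-- The fibre over 0 recovers L', its index j gives a = k / j, and the elements of the form (a, w)
recover the coset. -/
lemma ofHermiteData_injective {k : ℕ} : Function.Injective (ofHermiteData (A := A) (k := k)) := by
  rintro ⟨⟨j, hj⟩, ⟨L, hL⟩, q⟩ ⟨⟨j', hj'⟩, ⟨L', hL'⟩, q'⟩ h
  have h := congrArg Subtype.val h
  dsimp only [ofHermiteData] at h hL hL'
  have ne : ∀ i, i ∈ k.divisors → ((k / i : ℕ) : ℤ) ≠ 0 := by
    intro i hi
    have hd := Nat.mem_divisors.1 hi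
    exact_mod_cast (Nat.div_ne_zero_iff_of_dvd hd.1).2 ⟨hd.2, fun h => hd.2 (by
      simpa [h] using hd.1)⟩
  have e := congrArg (AddSubgroup.comap (AddMonoidHom.inr ℤ A)) h
  rw [comap_inr_hermite (ne j hj), comap_inr_hermite (ne j' hj')] at e
  subst e
  subst hL
  subst hL'
  have hm := mem_hermite_self ((k / L.index : ℕ) : ℤ) L q.out
  rw [h, pair_mem_hermite_iff (ne _ hj), ← QuotientAddGroup.eq_iff_sub_mem,
    QuotientAddGroup.out_eq', QuotientAddGroup.out_eq'] at hm
  rw [hm]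

lemma finite_quotient_of_mem_divisors {k : ℕ} (j : k.divisors) (L : OfIndex A j) :
    Finite (A ⧸ L.1) := by
  have : L.1.FiniteIndex := ⟨by rw [L.2]; exact (Nat.pos_of_mem_divisors j.2).ne'⟩
  exact finite_quotient_of_finiteIndex

lemma finite_ofIndex_int_prod (hA : ∀ j ≠ 0, Finite (OfIndex A j)) (k : ℕ) (hk : k ≠ 0) :
    Finite (OfIndex (ℤ × A) k) := by
  have := fun j : k.divisors => hA j (Nat.pos_of_mem_divisors j.2).ne'
  have := finite_quotient_of_mem_divisors (A := A) (k := k)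
  exact Finite.of_surjective _ (ofHermiteData_surjective hk)

lemma card_ofIndex_int_prod (hA : ∀ j ≠ 0, Finite (OfIndex A j)) {k : ℕ} (hk : k ≠ 0) :
    Nat.card (OfIndex (ℤ × A) k) = ∑ j ∈ k.divisors, j * Nat.card (OfIndex A j) := by
  have := fun j : k.divisors => hA j (Nat.pos_of_mem_divisors j.2).ne'
  have := finite_quotient_of_mem_divisors (A := A) (k := k)
  have := fun j : k.divisors => Fintype.ofFinite (OfIndex A j)
  rw [← Nat.card_congr (Equiv.ofBijective _ ⟨ofHermiteData_injective (A := A),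
    ofHermiteData_surjective hk⟩), Nat.card_sigma, ← Finset.sum_coe_sort k.divisors]
  refine Finset.sum_congr rfl fun j _ => ?_
  rw [Nat.card_sigma, Nat.card_eq_fintype_card, Finset.sum_congr rfl fun L _ =>
    show Nat.card (A ⧸ L.1) = j from L.2, Finset.sum_const, Finset.card_univ, smul_eq_mul, mul_comm]

/-! ### Reflection-stable lattices -/

/-- The subgroups of index `k` in `ℤ × A` that are stable under the reflection of the first
coordinate. -/
abbrev StableOfIndex (A : Type*) [AddCommGroup A] (k : ℕ) : Type _ :=
  {L : OfIndex (ℤ × A) k // ∀ v ∈ L.1, (-v.1, v.2) ∈ L.1}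

/-- If (a, w) and (-a, w) both lie in L, so does their sum (0, 2w). Thus the Hermite coset is
2-torsion, and the factor j of the full count drops to the constant c. -/
lemma card_stableOfIndex_le (hA : ∀ j ≠ 0, Finite (OfIndex A j)) {c : ℕ}
    (hc : ∀ L : AddSubgroup A, L.index ≠ 0 → Nat.card {q : A ⧸ L // q + q = 0} ≤ c)
    {k : ℕ} (hk : k ≠ 0) :
    Nat.card (StableOfIndex A k) ≤ c * ∑ j ∈ k.divisors, Nat.card (OfIndex A j) := by
  have := fun j : k.divisors => hA j (Nat.pos_of_mem_divisors j.2).ne'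
  have := finite_quotient_of_mem_divisors (A := A) (k := k)
  have := fun j : k.divisors => Fintype.ofFinite (OfIndex A j)
  let S := {d : HermiteData A k // d.2.2 + d.2.2 = 0}
  have hsurj : ∀ L : StableOfIndex A k, ∃ d : S, ofHermiteData d.1 = L.1 := by
    rintro ⟨L, hL⟩
    obtain ⟨d, rfl⟩ := ofHermiteData_surjective hk L
    refine ⟨⟨d, ?_⟩, rfl⟩
    have hd := Nat.mem_divisors.1 d.1.2
    have h0 : ((k / d.1 : ℕ) : ℤ) ≠ 0 := by
      exact_mod_cast (Nat.div_ne_zero_iff_of_dvd hd.1).2 ⟨hd.2, fun h => hd.2 (by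
        simpa [h] using hd.1)⟩
    have h1 := mem_hermite_self ((k / d.1 : ℕ) : ℤ) d.2.1.1 d.2.2.out
    have h2 : _ ∈ hermite ((k / d.1 : ℕ) : ℤ) d.2.1.1 d.2.2.out := hL _ h1
    have h3 := add_mem h1 h2
    rw [← QuotientAddGroup.out_eq' d.2.2, ← QuotientAddGroup.mk_add,
      QuotientAddGroup.eq_zero_iff]
    have h4 : d.2.2.out + d.2.2.out ∈
        (hermite ((k / d.1 : ℕ) : ℤ) d.2.1.1 d.2.2.out).comap (AddMonoidHom.inr ℤ A) := by
      simpa using h3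
    rwa [comap_inr_hermite h0] at h4
  choose f hf using hsurj
  have hinj : Function.Injective f := fun L L' h => Subtype.ext (by rw [← hf, ← hf, h])
  let e : S ≃ Σ j : k.divisors, Σ L : OfIndex A j, {q : A ⧸ L.1 // q + q = 0} :=
    { toFun := fun d => ⟨d.1.1, d.1.2.1, d.1.2.2, d.2⟩
      invFun := fun d => ⟨⟨d.1, d.2.1, d.2.2.1⟩, d.2.2.2⟩
      left_inv := fun _ => rfl
      right_inv := fun _ => rfl }
  refine (Nat.card_le_card_of_injective _ (e.injective.comp hinj)).trans ?_
  rw [Nat.card_sigma, Finset.mul_sum, ← Finset.sum_coe_sort k.divisors]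
  refine Finset.sum_le_sum fun j _ => ?_
  rw [Nat.card_sigma, Nat.card_eq_fintype_card, mul_comm]
  refine Finset.sum_le_card_nsmul _ _ _ fun L _ => hc L.1 ?_
  rw [L.2]
  exact (Nat.pos_of_mem_divisors j.2).ne'

/-- In the finite group Q = A/L, the kernel of doubling has order [Q : 2Q], and Q/2Q is a quotient
of A/2A. -/
lemma card_two_torsion_le (L : AddSubgroup A) (hL : L.index ≠ 0)
    (hA : (zsmulAddGroupHom (α := A) 2).range.index ≠ 0) :
    Nat.card {q : A ⧸ L // q + q = 0} ≤ (zsmulAddGroupHom (α := A) 2).range.index := by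
  have : L.FiniteIndex := ⟨hL⟩
  have hmap : (zsmulAddGroupHom (α := A) 2).range.map (QuotientAddGroup.mk' L) =
      (zsmulAddGroupHom (α := A ⧸ L) 2).range := by
    ext q
    constructor
    · rintro ⟨_, ⟨a, rfl⟩, rfl⟩
      exact ⟨(a : A ⧸ L), rfl⟩
    · rintro ⟨a, rfl⟩
      obtain ⟨a, rfl⟩ := QuotientAddGroup.mk'_surjective L a
      exact ⟨_, ⟨a, rfl⟩, rfl⟩
  have h1 := index_map_dvd (zsmulAddGroupHom (α := A) 2).range (QuotientAddGroup.mk'_surjective L)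
  rw [hmap, index_range] at h1
  have h2 : Nat.card {q : A ⧸ L // q + q = 0} =
      Nat.card (zsmulAddGroupHom (α := A ⧸ L) 2).ker :=
    Nat.card_congr (Equiv.subtypeEquivRight fun q => by
      rw [AddMonoidHom.mem_ker, zsmulAddGroupHom_apply, two_zsmul])
  rw [h2]
  exact Nat.le_of_dvd (Nat.pos_of_ne_zero hA) h1

/-! ### Counts for ℤ, ℤ² and ℤ³ -/

lemma index_range_two_int : (zsmulAddGroupHom (α := ℤ) 2).range.index = 2 := by
  have : (zsmulAddGroupHom (α := ℤ) 2).range = zmultiples 2 := by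
    ext n
    simp [mem_zmultiples_iff, mul_comm]
  rw [this, Int.index_zmultiples]; rfl

lemma index_range_two_int_prod :
    (zsmulAddGroupHom (α := ℤ × A) 2).range.index =
      2 * (zsmulAddGroupHom (α := A) 2).range.index := by
  have : (zsmulAddGroupHom (α := ℤ × A) 2).range =
      (zsmulAddGroupHom (α := ℤ) 2).range.prod (zsmulAddGroupHom (α := A) 2).range := by
    ext n
    simp [mem_prod, Prod.ext_iff]
  rw [this, index_prod, index_range_two_int]

lemma card_two_torsion_int_sq_le (L : AddSubgroup (ℤ × ℤ)) (hL : L.index ≠ 0) :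
    Nat.card {q : (ℤ × ℤ) ⧸ L // q + q = 0} ≤ 4 := by
  have h := index_range_two_int_prod (A := ℤ)
  rw [index_range_two_int] at h
  exact (card_two_torsion_le L hL (by simp [h])).trans h.le

lemma card_two_torsion_transLattice_le (L : AddSubgroup TransLattice) (hL : L.index ≠ 0) :
    Nat.card {q : TransLattice ⧸ L // q + q = 0} ≤ 8 := by
  have h := index_range_two_int_prod (A := ℤ × ℤ)
  rw [index_range_two_int_prod (A := ℤ), index_range_two_int] at h
  exact (card_two_torsion_le L hL (by simp [h])).trans h.le

/-- This includes k = 0: the trivial subgroup has infinite index, recorded as 0. -/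
lemma card_ofIndex_int (k : ℕ) : Nat.card (OfIndex ℤ k) = 1 := by
  rw [Nat.card_eq_one_iff_unique]
  refine ⟨⟨fun ⟨L, hL⟩ ⟨L', hL'⟩ => Subtype.ext ?_⟩, ⟨zmultiples (k : ℤ), by simp⟩⟩
  obtain ⟨b, hb⟩ := Int.subgroup_cyclic L
  obtain ⟨b', hb'⟩ := Int.subgroup_cyclic L'
  rw [← zmultiples_eq_closure] at hb hb'
  change L = L'
  subst hb hb'
  rw [Int.index_zmultiples] at hL hL'
  rw [← Int.zmultiples_natAbs b, ← Int.zmultiples_natAbs b', hL, hL']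

lemma finite_ofIndex_int (k : ℕ) : Finite (OfIndex ℤ k) :=
  Nat.finite_of_card_ne_zero (by rw [card_ofIndex_int k]; exact one_ne_zero)

lemma card_ofIndex_int_sq {k : ℕ} (hk : k ≠ 0) :
    Nat.card (OfIndex (ℤ × ℤ) k) = ∑ j ∈ k.divisors, j := by
  rw [card_ofIndex_int_prod (fun j _ => finite_ofIndex_int j) hk]
  refine Finset.sum_congr rfl fun j hj => ?_
  rw [card_ofIndex_int, mul_one]

lemma finite_ofIndex_transLattice (k : ℕ) (hk : k ≠ 0) : Finite (OfIndex TransLattice k) :=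
  finite_ofIndex_int_prod (finite_ofIndex_int_prod fun j _ => finite_ofIndex_int j) k hk

lemma card_ofIndex_transLattice {k : ℕ} (hk : k ≠ 0) :
    Nat.card (OfIndex TransLattice k) = ∑ j ∈ k.divisors, j * ∑ i ∈ j.divisors, i := by
  rw [card_ofIndex_int_prod (finite_ofIndex_int_prod fun j _ => finite_ofIndex_int j) hk]
  refine Finset.sum_congr rfl fun j hj => ?_
  rw [card_ofIndex_int_sq (Nat.pos_of_mem_divisors hj).ne']

lemma card_stableOfIndex_int_sq_le {k : ℕ} (hk : k ≠ 0) :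
    Nat.card (StableOfIndex (ℤ × ℤ) k) ≤ 4 * ∑ j ∈ k.divisors, ∑ i ∈ j.divisors, i := by
  refine (card_stableOfIndex_le (finite_ofIndex_int_prod fun j _ => finite_ofIndex_int j)
    card_two_torsion_int_sq_le hk).trans_eq ?_
  congr 1
  refine Finset.sum_congr rfl fun j hj => ?_
  rw [card_ofIndex_int_sq (Nat.pos_of_mem_divisors hj).ne']

end AddSubgroup

/-! ### Lattice and point group of a subgroup -/

namespace AffineP2m

/-- The translations contained in a subgroup. -/
def lattice (H : Subgroup AffineP2m) : AddSubgroup TransLattice :=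
  Subgroup.toAddSubgroup' (H.comap transHom)

/-- The point operations of a subgroup. -/
def pointGroup (H : Subgroup AffineP2m) : Subgroup PointSign := H.map signHom

lemma mem_lattice {H : Subgroup AffineP2m} {v : TransLattice} : v ∈ lattice H ↔ ⟨v, 1⟩ ∈ H :=
  Iff.rfl

lemma mem_pointGroup {H : Subgroup AffineP2m} {g : PointSign} :
    g ∈ pointGroup H ↔ ∃ t, ⟨t, g⟩ ∈ H :=
  ⟨fun ⟨a, ha, hg⟩ => ⟨a.trans, by rw [← hg]; exact ha⟩, fun ⟨t, ht⟩ => ⟨_, ht, rfl⟩⟩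

/-- With T the translations, compute the index of H ∩ T in two ways, through T (of index 4) and
through H. -/
lemma index_lattice_mul (H : Subgroup AffineP2m) :
    (lattice H).index * 4 = Nat.card (pointGroup H) * H.index := by
  have hker : signHom.ker = transHom.range := by
    ext a
    constructor
    · intro h
      exact ⟨Multiplicative.ofAdd a.trans, AffineP2m.ext rfl (MonoidHom.mem_ker.1 h).symm⟩
    · rintro ⟨v, rfl⟩
      rfl
  have hrange : signHom.range = ⊤ :=
    MonoidHom.range_eq_top.2 fun g => ⟨⟨0, g⟩, rfl⟩
  have hidx : (lattice H).index = (H.comap transHom).index := rfl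
  have h4 : signHom.ker.index = 4 := by
    rw [Subgroup.index_ker, hrange, Subgroup.card_top, Nat.card_eq_fintype_card]
    rfl
  rw [hidx, Subgroup.index_comap, ← hker, pointGroup, ← Subgroup.relIndex_ker, ← h4,
    ← Subgroup.inf_relIndex_right, Subgroup.relIndex_mul_index inf_le_right,
    ← Subgroup.inf_relIndex_left, Subgroup.relIndex_mul_index inf_le_left]

lemma mem_iff_sub_mem_lattice {H : Subgroup AffineP2m} {t : TransLattice} {g : PointSign}
    (ht : ⟨t, g⟩ ∈ H) (v : TransLattice) : ⟨v, g⟩ ∈ H ↔ v - t ∈ lattice H := by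
  have : (⟨v, g⟩ : AffineP2m) = ⟨v - t, 1⟩ * ⟨t, g⟩ := by ext <;> simp
  rw [this, H.mul_mem_cancel_right ht, mem_lattice]

lemma act_mem_lattice {H : Subgroup AffineP2m} {t v : TransLattice} {g : PointSign}
    (ht : ⟨t, g⟩ ∈ H) (hv : v ∈ lattice H) : act g v ∈ lattice H := by
  have := H.mul_mem (H.mul_mem ht (mem_lattice.1 hv)) (H.inv_mem ht)
  have e : (⟨t, g⟩ * ⟨v, 1⟩ * ⟨t, g⟩⁻¹ : AffineP2m) = ⟨act g v, 1⟩ := by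
    ext <;> simp [← mul_smul]
  rwa [e] at this

/-- Point operations are involutions, so the square of an element is a translation. -/
lemma add_act_mem_lattice {H : Subgroup AffineP2m} {t : TransLattice} {g : PointSign}
    (ht : ⟨t, g⟩ ∈ H) : t + act g t ∈ lattice H := by
  have h := H.mul_mem ht ht
  have e : (⟨t, g⟩ * ⟨t, g⟩ : AffineP2m) = ⟨t + act g t, 1⟩ := by
    exact AffineP2m.ext rfl ((by decide : ∀ g : PointSign, g * g = 1) g)
  rwa [e] at h

lemma neg_one_mem_pointGroup {H : Subgroup AffineP2m} (hm : (-1, 1) ∈ pointGroup H)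
    (hr : (1, -1) ∈ pointGroup H) : (-1, -1) ∈ pointGroup H := by
  simpa using mul_mem hm hr

/-! ### Subgroups with point group {1, -1} -/

/-- The subgroup generated by the translations from `L` and the inversion with translation
part `t`. -/
def centralExtension (L : AddSubgroup TransLattice) (t : TransLattice) : Subgroup AffineP2m where
  carrier := {a | (a.sign = 1 ∧ a.trans ∈ L) ∨ (a.sign = (-1, -1) ∧ a.trans - t ∈ L)}
  one_mem' := Or.inl ⟨rfl, L.zero_mem⟩
  mul_mem' := by
    rintro ⟨v, g⟩ ⟨w, h⟩ (⟨hg, hv⟩ | ⟨hg, hv⟩) (⟨hh, hw⟩ | ⟨hh, hw⟩) <;> dsimp only at hg hh hv hw <;>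
      subst hg hh
    · exact Or.inl ⟨rfl, by simpa using L.add_mem hv hw⟩
    · exact Or.inr ⟨rfl, by simpa [add_sub_assoc] using L.add_mem hv hw⟩
    -- Inversion only negates translations, so closure needs no condition on `L` or `t`.
    · refine Or.inr ⟨rfl, ?_⟩
      convert L.sub_mem hv hw using 1
      ext <;> simp <;> ring
    · refine Or.inl ⟨rfl, ?_⟩
      convert L.sub_mem hv hw using 1
      ext <;> simp <;> ring
  inv_mem' := by
    rintro ⟨v, g⟩ (⟨hg, hv⟩ | ⟨hg, hv⟩) <;> dsimp only at hg hv <;> subst hg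
    · exact Or.inl ⟨rfl, by simpa using L.neg_mem hv⟩
    · refine Or.inr ⟨rfl, ?_⟩
      convert hv using 1
      ext <;> simp

lemma mk_one_mem_centralExtension {L : AddSubgroup TransLattice} {t v : TransLattice} :
    ⟨v, 1⟩ ∈ centralExtension L t ↔ v ∈ L := by
  change (_ ∨ _) ↔ _
  simp [Prod.ext_iff]

lemma mk_neg_mem_centralExtension {L : AddSubgroup TransLattice} {t v : TransLattice} :
    ⟨v, (-1, -1)⟩ ∈ centralExtension L t ↔ v - t ∈ L := by
  change (_ ∨ _) ↔ _
  simp [Prod.ext_iff]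

lemma lattice_centralExtension (L : AddSubgroup TransLattice) (t : TransLattice) :
    lattice (centralExtension L t) = L := by
  ext v
  rw [mem_lattice, mk_one_mem_centralExtension]

/-- Subgroups with point group generated by the inversion. -/
def IsCentral (H : Subgroup AffineP2m) : Prop := ∀ g, g ∈ pointGroup H ↔ g = 1 ∨ g = (-1, -1)

lemma isCentral_centralExtension (L : AddSubgroup TransLattice) (t : TransLattice) :
    IsCentral (centralExtension L t) := by
  intro g
  rw [mem_pointGroup]
  constructor
  · rintro ⟨v, ⟨h, -⟩ | ⟨h, -⟩⟩
    · exact Or.inl h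
    · exact Or.inr h
  · rintro (rfl | rfl)
    · exact ⟨0, one_mem _⟩
    · exact ⟨t, mk_neg_mem_centralExtension.2 (by simp)⟩

lemma IsCentral.eq_centralExtension {H : Subgroup AffineP2m} (hH : IsCentral H)
    {t : TransLattice} (ht : ⟨t, (-1, -1)⟩ ∈ H) : H = centralExtension (lattice H) t := by
  ext ⟨v, g⟩
  constructor
  · intro hv
    rcases (hH g).1 (mem_pointGroup.2 ⟨v, hv⟩) with rfl | rfl
    · exact mk_one_mem_centralExtension.2 hv
    · exact mk_neg_mem_centralExtension.2 ((mem_iff_sub_mem_lattice ht v).1 hv)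
  · rintro (⟨h, hv⟩ | ⟨h, hv⟩) <;> dsimp only at h hv <;> subst h
    · exact hv
    · exact (mem_iff_sub_mem_lattice ht v).2 hv

lemma IsCentral.index_eq {H : Subgroup AffineP2m} (hH : IsCentral H) :
    H.index = 2 * (lattice H).index := by
  have h := index_lattice_mul H
  have h2 : Nat.card (pointGroup H) = 2 := by
    rw [Nat.card_congr (Equiv.subtypeEquivRight hH), Nat.card_eq_fintype_card]
    rfl
  rw [h2] at h
  omega

lemma index_lattice_le (H : Subgroup AffineP2m) : (lattice H).index ≤ H.index := by
  have h := index_lattice_mul H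
  have h2 : Nat.card (pointGroup H) ≤ 4 :=
    (Subgroup.card_le_card_group _).trans_eq (by rw [Nat.card_eq_fintype_card]; rfl)
  nlinarith

lemma index_lattice_ne_zero {H : Subgroup AffineP2m} (hH : H.index ≠ 0) :
    (lattice H).index ≠ 0 := by
  have h := index_lattice_mul H
  have h2 : Nat.card (pointGroup H) ≠ 0 := Nat.card_pos.ne'
  intro h0
  rw [h0, zero_mul] at h
  exact mul_ne_zero h2 hH h.symm

lemma finite_quotient {k : ℕ} (hk : k ≠ 0) (L : AddSubgroup.OfIndex TransLattice k) :
    Finite (TransLattice ⧸ L.1) := by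
  have : L.1.FiniteIndex := ⟨by rw [L.2]; exact hk⟩
  exact AddSubgroup.finite_quotient_of_finiteIndex

/-- Subgroups with point group generated by the inversion correspond to a lattice and a coset. -/
noncomputable def ofCentralData {k : ℕ}
    (d : Σ L : AddSubgroup.OfIndex TransLattice k, TransLattice ⧸ L.1) :
    {H : Subgroup AffineP2m // IsCentral H ∧ (lattice H).index = k} :=
  ⟨centralExtension d.1.1 d.2.out, isCentral_centralExtension _ _, by
    rw [lattice_centralExtension, d.1.2]⟩

lemma ofCentralData_bijective {k : ℕ} : Function.Bijective (ofCentralData (k := k)) := by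
  constructor
  · rintro ⟨⟨L, hL⟩, q⟩ ⟨⟨L', hL'⟩, q'⟩ h
    have h : centralExtension L q.out = centralExtension L' q'.out := congrArg Subtype.val h
    have e := congrArg lattice h
    rw [lattice_centralExtension, lattice_centralExtension] at e
    subst e
    have hm : (⟨q.out, (-1, -1)⟩ : AffineP2m) ∈ centralExtension L q.out :=
      mk_neg_mem_centralExtension.2 (by simp)
    rw [h, mk_neg_mem_centralExtension, ← QuotientAddGroup.eq_iff_sub_mem,
      QuotientAddGroup.out_eq', QuotientAddGroup.out_eq'] at hm
    rw [hm]
  · rintro ⟨H, hH, rfl⟩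
    obtain ⟨t, ht⟩ := mem_pointGroup.1 ((hH (-1, -1)).2 (Or.inr rfl))
    have ht' : (⟨(t : TransLattice ⧸ lattice H).out, (-1, -1)⟩ : AffineP2m) ∈ H := by
      rw [mem_iff_sub_mem_lattice ht, ← QuotientAddGroup.eq_iff_sub_mem,
        QuotientAddGroup.out_eq']
    exact ⟨⟨⟨lattice H, rfl⟩, (t : TransLattice ⧸ lattice H)⟩,
      Subtype.ext (hH.eq_centralExtension ht').symm⟩

lemma finite_central {k : ℕ} (hk : k ≠ 0) :
    Finite {H : Subgroup AffineP2m // IsCentral H ∧ (lattice H).index = k} := by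
  have := AddSubgroup.finite_ofIndex_transLattice k hk
  have := finite_quotient hk
  exact Finite.of_surjective _ ofCentralData_bijective.2

lemma card_central {k : ℕ} (hk : k ≠ 0) :
    Nat.card {H : Subgroup AffineP2m // IsCentral H ∧ (lattice H).index = k} =
      k * Nat.card (AddSubgroup.OfIndex TransLattice k) := by
  have := AddSubgroup.finite_ofIndex_transLattice k hk
  have := Fintype.ofFinite (AddSubgroup.OfIndex TransLattice k)
  have := finite_quotient hk
  rw [← Nat.card_congr (Equiv.ofBijective _ ofCentralData_bijective), Nat.card_sigma,
    Nat.card_eq_fintype_card, Finset.sum_congr rfl fun L _ =>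
      show Nat.card (TransLattice ⧸ L.1) = k from L.2, Finset.sum_const, Finset.card_univ,
    smul_eq_mul, mul_comm]

/-! ### Bounds for the remaining point groups -/

/-- Two subgroups with the same lattice have the same elements over `g` if the translation parts
over `g` lie in the same coset of the lattice. -/
lemma mem_iff_of_lattice_eq {H H' : Subgroup AffineP2m} (hL : lattice H = lattice H')
    {g : PointSign} {t t' : TransLattice} (ht : ⟨t, g⟩ ∈ H) (ht' : ⟨t', g⟩ ∈ H')
    (h : (t : TransLattice ⧸ lattice H) = t') (v : TransLattice) :
    ⟨v, g⟩ ∈ H ↔ ⟨v, g⟩ ∈ H' := by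
  rw [QuotientAddGroup.eq_iff_sub_mem] at h
  rw [mem_iff_sub_mem_lattice ht, mem_iff_sub_mem_lattice ht', ← hL,
    ← (lattice H).add_mem_cancel_right h, sub_add_sub_cancel]

lemma mem_iff_of_notMem {H H' : Subgroup AffineP2m} {g : PointSign} (h : g ∉ pointGroup H)
    (h' : g ∉ pointGroup H') (v : TransLattice) : ⟨v, g⟩ ∈ H ↔ ⟨v, g⟩ ∈ H' :=
  iff_of_false (fun hv => h (mem_pointGroup.2 ⟨v, hv⟩)) fun hv => h' (mem_pointGroup.2 ⟨v, hv⟩)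

lemma ext_of_signs {H H' : Subgroup AffineP2m} (hL : lattice H = lattice H')
    (hm : ∀ v, ⟨v, (-1, 1)⟩ ∈ H ↔ ⟨v, (-1, 1)⟩ ∈ H')
    (hr : ∀ v, ⟨v, (1, -1)⟩ ∈ H ↔ ⟨v, (1, -1)⟩ ∈ H')
    (hc : ∀ v, ⟨v, (-1, -1)⟩ ∈ H ↔ ⟨v, (-1, -1)⟩ ∈ H') : H = H' := by
  ext ⟨v, d, e⟩
  rcases Int.units_eq_one_or d with rfl | rfl <;> rcases Int.units_eq_one_or e with rfl | rfl
  · exact SetLike.ext_iff.1 hL v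
  · exact hr v
  · exact hm v
  · exact hc v

lemma mul_mem_pointGroup_iff {H : Subgroup AffineP2m} {g h : PointSign}
    (hg : g ∈ pointGroup H) : g * h ∈ pointGroup H ↔ h ∈ pointGroup H :=
  Subgroup.mul_mem_cancel_left _ hg

/-- A bound for the number of subgroups with lattice `L` whose point group has order two and is not
generated by the inversion. -/
lemma card_point_order_two_le {L : AddSubgroup TransLattice} [Finite (TransLattice ⧸ L)]
    {g h : PointSign} (hgh : (g = (-1, 1) ∧ h = (1, -1)) ∨ (g = (1, -1) ∧ h = (-1, 1))) :
    Finite {H : Subgroup AffineP2m // lattice H = L ∧ g ∈ pointGroup H ∧ h ∉ pointGroup H} ∧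
    Nat.card {H : Subgroup AffineP2m // lattice H = L ∧ g ∈ pointGroup H ∧ h ∉ pointGroup H} ≤
      L.index := by
  have hex : ∀ H : {H : Subgroup AffineP2m //
      lattice H = L ∧ g ∈ pointGroup H ∧ h ∉ pointGroup H}, ∃ t, ⟨t, g⟩ ∈ H.1 :=
    fun H => mem_pointGroup.1 H.2.2.1
  choose t ht using hex
  -- Since g lies in the point group and h does not, gh does not either; the coset over g alone
  -- determines the subgroup.
  have hc : (-1, -1) = g * h := by
    rcases hgh with ⟨rfl, rfl⟩ | ⟨rfl, rfl⟩ <;> rfl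
  have hinj : Function.Injective fun H => (t H : TransLattice ⧸ L) := by
    rintro ⟨H, rfl, hg, hh⟩ ⟨H', hL', hg', hh'⟩ htt
    have hG := mem_iff_of_lattice_eq hL'.symm (ht ⟨H, rfl, hg, hh⟩) (ht ⟨H', hL', hg', hh'⟩) htt
    have hH := mem_iff_of_notMem hh hh'
    have hC : ∀ v, ⟨v, (-1, -1)⟩ ∈ H ↔ ⟨v, (-1, -1)⟩ ∈ H' := by
      rw [hc]
      exact mem_iff_of_notMem (by rwa [mul_mem_pointGroup_iff hg])
        (by rwa [mul_mem_pointGroup_iff hg'])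
    refine Subtype.ext ?_
    rcases hgh with ⟨rfl, rfl⟩ | ⟨rfl, rfl⟩
    · exact ext_of_signs hL'.symm hG hH hC
    · exact ext_of_signs hL'.symm hH hG hC
  exact ⟨Finite.of_injective _ hinj, Nat.card_le_card_of_injective _ hinj⟩

/-- There are at most [ℤ³ : L] cosets over the inversion. Once that coset is fixed, the coset over
the rotation varies by 2-torsion of ℤ³/L, at most 8 elements, and the coset over the reflection is
their difference. -/
lemma card_point_full_le {L : AddSubgroup TransLattice} [Finite (TransLattice ⧸ L)] :
    Finite {H : Subgroup AffineP2m //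
      lattice H = L ∧ (-1, 1) ∈ pointGroup H ∧ (1, -1) ∈ pointGroup H} ∧
    Nat.card {H : Subgroup AffineP2m //
      lattice H = L ∧ (-1, 1) ∈ pointGroup H ∧ (1, -1) ∈ pointGroup H} ≤ L.index * 8 := by
  set S := {H : Subgroup AffineP2m //
    lattice H = L ∧ (-1, 1) ∈ pointGroup H ∧ (1, -1) ∈ pointGroup H} with hS
  have hexr : ∀ H : S, ∃ t, ⟨t, (1, -1)⟩ ∈ H.1 := fun H => mem_pointGroup.1 H.2.2.2
  have hexc : ∀ H : S, ∃ t, ⟨t, (-1, -1)⟩ ∈ H.1 := fun H =>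
    mem_pointGroup.1 (neg_one_mem_pointGroup H.2.2.1 H.2.2.2)
  choose t ht using hexr
  choose u hu using hexc
  have htors : ∀ H H' : S, (u H : TransLattice ⧸ L) = u H' →
      ((t H - t H' : TransLattice) : TransLattice ⧸ L) +
        ((t H - t H' : TransLattice) : TransLattice ⧸ L) = 0 := by
    intro H H' h
    have hu' : ⟨u H, (-1, -1)⟩ ∈ H'.1 := by
      rw [mem_iff_sub_mem_lattice (hu H'), H'.2.1, ← QuotientAddGroup.eq_iff_sub_mem, h]
    -- The squares of the rotation and of the reflection in `K` give these two lattice vectors.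
    -- Comparing `H` and `H'` with a common `w` puts twice the difference of their rotation parts in
    -- `L`.
    have key : ∀ (K : S) (w : TransLattice), ⟨w, (-1, -1)⟩ ∈ K.1 →
        ((2 * (t K).1, 0) : TransLattice) ∈ L ∧ ((0, 2 • (w.2 - (t K).2)) : TransLattice) ∈ L := by
      intro K w hw
      constructor
      · have := add_act_mem_lattice (ht K)
        rw [K.2.1] at this
        convert this using 1
        ext <;> simp
        ring
      · have hm : (⟨w - t K, (-1, 1)⟩ : AffineP2m) ∈ K.1 := by
          convert K.1.mul_mem hw (ht K) using 1
          ext <;> simp <;> ring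
        have := add_act_mem_lattice hm
        rw [K.2.1] at this
        convert this using 1
        ext <;> simp <;> ring
    obtain ⟨h1, h2⟩ := key H _ (hu H)
    obtain ⟨h3, h4⟩ := key H' _ hu'
    rw [← QuotientAddGroup.mk_add, QuotientAddGroup.eq_zero_iff]
    convert L.sub_mem (L.add_mem (L.sub_mem h1 h3) h4) h2 using 1
    ext <;> simp <;> ring
  -- A base point for each inversion coset turns differences into 2-torsion elements; where no
  -- subgroup occurs, 0 is a dummy.
  have hbase : ∀ q : TransLattice ⧸ L, ∃ b : TransLattice, ∀ H : S, (u H : TransLattice ⧸ L) = q →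
      ((t H - b : TransLattice) : TransLattice ⧸ L) +
        ((t H - b : TransLattice) : TransLattice ⧸ L) = 0 := by
    intro q
    by_cases hq : ∃ H : S, (u H : TransLattice ⧸ L) = q
    · obtain ⟨H', rfl⟩ := hq
      exact ⟨t H', fun H hH => htors H H' hH⟩
    · exact ⟨0, fun H hH => (hq ⟨H, hH⟩).elim⟩
  choose b hb using hbase
  let f : S → (TransLattice ⧸ L) × {q : TransLattice ⧸ L // q + q = 0} := fun H =>
    (u H, ⟨_, hb (u H) H rfl⟩)
  have hinj : Function.Injective f := by
    intro H H' h
    have hu1 : (u H : TransLattice ⧸ L) = u H' := congrArg Prod.fst h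
    have ht1 : ((t H - b (u H) : TransLattice) : TransLattice ⧸ L) =
        ((t H' - b (u H') : TransLattice) : TransLattice ⧸ L) :=
      congrArg (fun p => p.2.1) h
    rw [hu1, QuotientAddGroup.mk_sub, QuotientAddGroup.mk_sub, sub_left_inj] at ht1
    obtain ⟨H, rfl, hm, hr⟩ := H
    obtain ⟨H', hL', hm', hr'⟩ := H'
    have hR := mem_iff_of_lattice_eq hL'.symm (ht ⟨H, rfl, hm, hr⟩) (ht ⟨H', hL', hm', hr'⟩) ht1
    have hC := mem_iff_of_lattice_eq hL'.symm (hu ⟨H, rfl, hm, hr⟩) (hu ⟨H', hL', hm', hr'⟩) hu1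
    have hmK : ∀ K : S, ⟨u K - t K, (-1, 1)⟩ ∈ K.1 := by
      intro K
      convert K.1.mul_mem (hu K) (ht K) using 1
      ext <;> simp <;> ring
    have hM := mem_iff_of_lattice_eq hL'.symm (hmK ⟨H, rfl, hm, hr⟩) (hmK ⟨H', hL', hm', hr'⟩)
      (by rw [QuotientAddGroup.mk_sub, QuotientAddGroup.mk_sub, hu1, ht1])
    exact Subtype.ext (ext_of_signs hL'.symm hM hR hC)
  refine ⟨Finite.of_injective _ hinj, (Nat.card_le_card_of_injective _ hinj).trans ?_⟩
  rw [Nat.card_prod]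
  refine Nat.mul_le_mul le_rfl (AddSubgroup.card_two_torsion_transLattice_le L ?_)
  exact AddSubgroup.index_ne_zero_of_finite

/-- The conditions force the point group to be trivial, so H consists of the translations in L. -/
lemma subsingleton_point_trivial (L : AddSubgroup TransLattice) :
    {H : Subgroup AffineP2m | lattice H = L ∧ ¬IsCentral H ∧ (-1, 1) ∉ pointGroup H ∧
      (1, -1) ∉ pointGroup H}.Subsingleton := by
  have key : ∀ H : Subgroup AffineP2m, ¬IsCentral H → (-1, 1) ∉ pointGroup H →
      (1, -1) ∉ pointGroup H → (-1, -1) ∉ pointGroup H := by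
    intro H hH hm hr hc
    refine hH fun ⟨d, e⟩ => ?_
    rcases Int.units_eq_one_or d with rfl | rfl <;> rcases Int.units_eq_one_or e with rfl | rfl
    · exact iff_of_true (one_mem _) (Or.inl rfl)
    · exact iff_of_false hr (by decide)
    · exact iff_of_false hm (by decide)
    · exact iff_of_true hc (Or.inr rfl)
  rintro H ⟨hL, hH, hm, hr⟩ H' ⟨hL', hH', hm', hr'⟩
  exact ext_of_signs (hL.trans hL'.symm) (mem_iff_of_notMem hm hm')
    (mem_iff_of_notMem hr hr') (mem_iff_of_notMem (key H hH hm hr) (key H' hH' hm' hr'))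

/-- The reflection m acts in exactly this way, and the rotation r acts as its negative. -/
lemma neg_fst_mem_lattice {H : Subgroup AffineP2m}
    (h : (-1, 1) ∈ pointGroup H ∨ (1, -1) ∈ pointGroup H) {v : TransLattice} (hv : v ∈ lattice H) :
    (-v.1, v.2) ∈ lattice H := by
  rcases h with h | h <;> obtain ⟨t, ht⟩ := mem_pointGroup.1 h
  · convert act_mem_lattice ht hv using 1
    ext <;> simp
  · convert (lattice H).neg_mem (act_mem_lattice ht hv) using 1
    ext <;> simp

open Classical in
-- The 1 is the trivial point group. The 10 is 1 + 1 + 8, from the point groups ⟨m⟩, ⟨r⟩ and the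
-- full one, which all require a stable lattice.
lemma ncard_noncentral_of_lattice_le {L : AddSubgroup TransLattice} (hL : L.index ≠ 0) :
    {H : Subgroup AffineP2m | lattice H = L ∧ ¬IsCentral H}.Finite ∧
    {H : Subgroup AffineP2m | lattice H = L ∧ ¬IsCentral H}.ncard ≤
      1 + if ∀ v ∈ L, (-v.1, v.2) ∈ L then 10 * L.index else 0 := by
  have : L.FiniteIndex := ⟨hL⟩
  have hfin : Finite (TransLattice ⧸ L) := AddSubgroup.finite_quotient_of_finiteIndex
  set E0 := {H : Subgroup AffineP2m |
    lattice H = L ∧ ¬IsCentral H ∧ (-1, 1) ∉ pointGroup H ∧ (1, -1) ∉ pointGroup H} with hE0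
  set Em := {H : Subgroup AffineP2m |
    lattice H = L ∧ (-1, 1) ∈ pointGroup H ∧ (1, -1) ∉ pointGroup H} with hEm
  set Er := {H : Subgroup AffineP2m |
    lattice H = L ∧ (1, -1) ∈ pointGroup H ∧ (-1, 1) ∉ pointGroup H} with hEr
  set Ef := {H : Subgroup AffineP2m |
    lattice H = L ∧ (-1, 1) ∈ pointGroup H ∧ (1, -1) ∈ pointGroup H} with hEf
  have s0 : E0.Subsingleton := subsingleton_point_trivial L
  have f0 : E0.Finite := s0.finite
  have c0 : E0.ncard ≤ 1 := (Set.ncard_le_one f0).2 fun a ha b hb => s0 ha hb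
  obtain ⟨fm, cm⟩ := card_point_order_two_le (L := L) (Or.inl ⟨rfl, rfl⟩)
  obtain ⟨fr, cr⟩ := card_point_order_two_le (L := L) (Or.inr ⟨rfl, rfl⟩)
  obtain ⟨ff, cf⟩ := card_point_full_le (L := L)
  have fU : (E0 ∪ (Em ∪ Er ∪ Ef)).Finite :=
    f0.union ((Set.Finite.union fm fr).union ff)
  have hsub : {H : Subgroup AffineP2m | lattice H = L ∧ ¬IsCentral H} ⊆ E0 ∪ (Em ∪ Er ∪ Ef) := by
    rintro H ⟨h1, h2⟩
    by_cases hm : (-1, 1) ∈ pointGroup H <;> by_cases hr : (1, -1) ∈ pointGroup H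
    · exact Or.inr (Or.inr ⟨h1, hm, hr⟩)
    · exact Or.inr (Or.inl (Or.inl ⟨h1, hm, hr⟩))
    · exact Or.inr (Or.inl (Or.inr ⟨h1, hr, hm⟩))
    · exact Or.inl ⟨h1, h2, hm, hr⟩
  refine ⟨fU.subset hsub, ?_⟩
  by_cases hst : ∀ v ∈ L, (-v.1, v.2) ∈ L
  · rw [if_pos hst]
    have cm : Em.ncard ≤ L.index := cm
    have cr : Er.ncard ≤ L.index := cr
    have cf : Ef.ncard ≤ L.index * 8 := cf
    have h1 := Set.ncard_le_ncard hsub fU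
    have h2 := Set.ncard_union_le E0 (Em ∪ Er ∪ Ef)
    have h3 := Set.ncard_union_le (Em ∪ Er) Ef
    have h4 := Set.ncard_union_le Em Er
    omega
  · rw [if_neg hst, add_zero]
    refine (Set.ncard_le_ncard (t := E0) (fun H hH => ?_) f0).trans c0
    refine ⟨hH.1, hH.2, ?_⟩
    rw [← not_or]
    intro h
    exact hst fun v hv => by
      rw [← hH.1] at hv ⊢
      exact neg_fst_mem_lattice h hv

open Classical in
lemma ncard_noncentral_le {k : ℕ} (hk : k ≠ 0) :
    {H : Subgroup AffineP2m | (lattice H).index = k ∧ ¬IsCentral H}.Finite ∧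
    {H : Subgroup AffineP2m | (lattice H).index = k ∧ ¬IsCentral H}.ncard ≤
      Nat.card (AddSubgroup.OfIndex TransLattice k) +
        10 * (k * Nat.card (AddSubgroup.StableOfIndex (ℤ × ℤ) k)) := by
  have := AddSubgroup.finite_ofIndex_transLattice k hk
  have := Fintype.ofFinite (AddSubgroup.OfIndex TransLattice k)
  have hL : ∀ L : AddSubgroup.OfIndex TransLattice k, L.1.index ≠ 0 := fun L => by
    rw [L.2]; exact hk
  have hfin : ∀ L : AddSubgroup.OfIndex TransLattice k,
      Finite {H : Subgroup AffineP2m | lattice H = L.1 ∧ ¬IsCentral H} := fun L =>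
    (ncard_noncentral_of_lattice_le (hL L)).1
  let f : {H : Subgroup AffineP2m | (lattice H).index = k ∧ ¬IsCentral H} →
      Σ L : AddSubgroup.OfIndex TransLattice k,
        {H : Subgroup AffineP2m | lattice H = L.1 ∧ ¬IsCentral H} := fun H =>
    ⟨⟨lattice H.1, H.2.1⟩, ⟨H.1, rfl, H.2.2⟩⟩
  have hinj : Function.Injective f := fun H H' h =>
    Subtype.ext (congrArg (fun p => p.2.1) h)
  refine ⟨Finite.of_injective f hinj, (Nat.card_le_card_of_injective f hinj).trans ?_⟩
  rw [Nat.card_sigma]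
  refine (Finset.sum_le_sum fun L _ => (ncard_noncentral_of_lattice_le (hL L)).2).trans_eq ?_
  have hS : Nat.card (AddSubgroup.StableOfIndex (ℤ × ℤ) k) = (Finset.univ.filter
      fun L : AddSubgroup.OfIndex TransLattice k => ∀ v ∈ L.1, (-v.1, v.2) ∈ L.1).card := by
    rw [Nat.card_eq_fintype_card, Fintype.card_subtype]
  rw [hS, Finset.sum_add_distrib, Finset.sum_const, Finset.card_univ, smul_eq_mul, mul_one,
    Nat.card_eq_fintype_card, ← Finset.sum_filter, Finset.sum_congr rfl fun L _ =>
      show 10 * L.1.index = 10 * k by rw [L.2], Finset.sum_const, smul_eq_mul]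
  ring

end AffineP2m

/-- An isomorphism preserves the number of subgroups of given index. -/
lemma numSubgroupsOfIndex_congr {G G' : Type*} [Group G] [Group G'] (e : G ≃* G') (n : ℕ) :
    numSubgroupsOfIndex G n = numSubgroupsOfIndex G' n := by
  refine Nat.card_congr (Equiv.subtypeEquiv e.mapSubgroup.toEquiv fun H => ?_)
  change H.index = n ↔ (H.map (e : G →* G')).index = n
  rw [Subgroup.index_map_equiv]

/-! ### Sorting subgroups by their index -/

namespace AffineP2m

lemma finite_central_of_index {n : ℕ} (hn : n ≠ 0) :
    {H : Subgroup AffineP2m | H.index = n ∧ IsCentral H}.Finite := by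
  by_cases h : ∃ k, n = 2 * k
  · obtain ⟨k, rfl⟩ := h
    refine Set.Finite.subset (s := {H | IsCentral H ∧ (lattice H).index = k})
      (finite_central (by omega)) fun H hH => ⟨hH.2, ?_⟩
    have := hH.2.index_eq
    have := hH.1
    omega
  · refine Set.Finite.subset Set.finite_empty fun H hH =>
      (h ⟨(lattice H).index, ?_⟩).elim
    rw [← hH.1, hH.2.index_eq]

lemma ncard_central_two_mul {k : ℕ} (hk : k ≠ 0) :
    {H : Subgroup AffineP2m | H.index = 2 * k ∧ IsCentral H}.ncard =
      k * Nat.card (AddSubgroup.OfIndex TransLattice k) := by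
  rw [← card_central hk]
  refine Nat.card_congr (Equiv.subtypeEquivRight fun H => ?_)
  constructor
  · rintro ⟨h, hH⟩
    exact ⟨hH, by have := hH.index_eq; omega⟩
  · rintro ⟨hH, h⟩
    exact ⟨by rw [hH.index_eq, h], hH⟩

lemma ncard_central_of_odd {n : ℕ} (hn : ¬2 ∣ n) :
    {H : Subgroup AffineP2m | H.index = n ∧ IsCentral H}.ncard = 0 := by
  convert Set.ncard_empty (Subgroup AffineP2m)
  ext H
  refine iff_of_false ?_ (Set.notMem_empty H)
  rintro ⟨h, hH⟩
  exact hn ⟨_, by rw [← h, hH.index_eq]⟩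

lemma finite_noncentral_of_index {n : ℕ} (hn : n ≠ 0) :
    {H : Subgroup AffineP2m | H.index = n ∧ ¬IsCentral H}.Finite := by
  refine Set.Finite.subset (s := ⋃ k ∈ Set.Icc 1 n,
    {H : Subgroup AffineP2m | (lattice H).index = k ∧ ¬IsCentral H})
    ((Set.finite_Icc 1 n).biUnion fun k hk => (ncard_noncentral_le (by grind)).1) ?_
  rintro H ⟨rfl, hH⟩
  simp only [Set.mem_iUnion]
  exact ⟨_, ⟨Nat.one_le_iff_ne_zero.2 (index_lattice_ne_zero hn), index_lattice_le H⟩, rfl, hH⟩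

lemma setOf_index_eq (n : ℕ) : {H : Subgroup AffineP2m | H.index = n} =
    {H | H.index = n ∧ IsCentral H} ∪ {H | H.index = n ∧ ¬IsCentral H} := by
  ext H
  simp only [Set.mem_ofPred_eq, Set.mem_union]
  tauto

lemma finite_of_index {n : ℕ} (hn : n ≠ 0) : {H : Subgroup AffineP2m | H.index = n}.Finite := by
  rw [setOf_index_eq]
  exact (finite_central_of_index hn).union (finite_noncentral_of_index hn)

lemma numSubgroupsOfIndex_eq {n : ℕ} (hn : n ≠ 0) : numSubgroupsOfIndex AffineP2m n =
    {H : Subgroup AffineP2m | H.index = n ∧ IsCentral H}.ncard +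
      {H : Subgroup AffineP2m | H.index = n ∧ ¬IsCentral H}.ncard := by
  rw [numSubgroupsOfIndex, setOf_index_eq, Set.ncard_union_eq _ (finite_central_of_index hn)
    (finite_noncentral_of_index hn)]
  exact Set.disjoint_left.2 fun H h h' => h'.2 h.2

lemma sum_ncard_central (N : ℕ) :
    ∑ n ∈ Finset.Icc 1 N, {H : Subgroup AffineP2m | H.index = n ∧ IsCentral H}.ncard =
      ∑ k ∈ Finset.Icc 1 (N / 2), k * Nat.card (AddSubgroup.OfIndex TransLattice k) := by
  symm
  refine Finset.sum_of_injOn (fun k => 2 * k) (fun a _ b _ h => by simpa using h) ?_ ?_ ?_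
  · intro k hk
    simp only [Finset.coe_Icc, Set.mem_Icc] at hk ⊢
    omega
  · intro n hn hn'
    refine ncard_central_of_odd ?_
    rintro ⟨k, rfl⟩
    refine hn' ⟨k, ?_, rfl⟩
    simp only [Finset.coe_Icc, Set.mem_Icc, Finset.mem_Icc] at hn ⊢
    omega
  · intro k hk
    rw [ncard_central_two_mul]
    have := (Finset.mem_Icc.1 hk).1
    omega

/-- Regroup by lattice index, which is nonzero and at most the index of the subgroup, hence stays in
the range 1 to N. -/
lemma sum_ncard_noncentral_le (N : ℕ) :
    ∑ n ∈ Finset.Icc 1 N, {H : Subgroup AffineP2m | H.index = n ∧ ¬IsCentral H}.ncard ≤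
      ∑ k ∈ Finset.Icc 1 N,
        {H : Subgroup AffineP2m | (lattice H).index = k ∧ ¬IsCentral H}.ncard := by
  have hne : ∀ n : Finset.Icc 1 N, n.1 ≠ 0 := fun n =>
    Nat.one_le_iff_ne_zero.1 (Finset.mem_Icc.1 n.2).1
  have h1 : ∀ n : Finset.Icc 1 N,
      Finite {H : Subgroup AffineP2m | H.index = n ∧ ¬IsCentral H} :=
    fun n => finite_noncentral_of_index (hne n)
  have h2 : ∀ n : Finset.Icc 1 N,
      Finite {H : Subgroup AffineP2m | (lattice H).index = n ∧ ¬IsCentral H} :=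
    fun n => (ncard_noncentral_le (hne n)).1
  let f : (Σ n : Finset.Icc 1 N, {H : Subgroup AffineP2m | H.index = n ∧ ¬IsCentral H}) →
      Σ n : Finset.Icc 1 N, {H : Subgroup AffineP2m | (lattice H).index = n ∧ ¬IsCentral H} :=
    fun p => ⟨⟨(lattice p.2.1).index, Finset.mem_Icc.2
      ⟨Nat.one_le_iff_ne_zero.2 (index_lattice_ne_zero (by rw [p.2.2.1]; exact hne _)),
      (index_lattice_le _).trans (by rw [p.2.2.1]; exact (Finset.mem_Icc.1 p.1.2).2)⟩⟩,
      ⟨p.2.1, rfl, p.2.2.2⟩⟩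
  have hinj : Function.Injective f := by
    rintro ⟨⟨n, hn⟩, H, hH, hH2⟩ ⟨⟨n', hn'⟩, H', hH', hH2'⟩ h
    have h : H = H' := congrArg (fun p => p.2.1) h
    subst h
    dsimp only at hH hH'
    subst hH
    subst hH'
    rfl
  have := Nat.card_le_card_of_injective f hinj
  rw [Nat.card_sigma, Nat.card_sigma] at this
  rw [← Finset.sum_coe_sort, ← Finset.sum_coe_sort (Finset.Icc 1 N)]
  exact this

lemma sum_ncard_noncentral_le' (N : ℕ) :
    ∑ n ∈ Finset.Icc 1 N, {H : Subgroup AffineP2m | H.index = n ∧ ¬IsCentral H}.ncard ≤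
      41 * N * ∑ k ∈ Finset.Icc 1 N, ∑ j ∈ k.divisors, ∑ i ∈ j.divisors, i := by
  refine (sum_ncard_noncentral_le N).trans ?_
  rw [Finset.mul_sum]
  refine Finset.sum_le_sum fun k hk => ?_
  obtain ⟨hk1, hkN⟩ := Finset.mem_Icc.1 hk
  have hk0 : k ≠ 0 := by omega
  refine (ncard_noncentral_le hk0).2.trans ?_
  rw [AddSubgroup.card_ofIndex_transLattice hk0]
  -- This accounts for 1 in the constant 41 = 1 + 10 · 4; the rest comes from the stable lattices.
  have h1 : ∑ j ∈ k.divisors, j * ∑ i ∈ j.divisors, i ≤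
      k * ∑ j ∈ k.divisors, ∑ i ∈ j.divisors, i := by
    rw [Finset.mul_sum]
    exact Finset.sum_le_sum fun j hj => Nat.mul_le_mul_right _ (Nat.divisor_le hj)
  have h2 := Nat.mul_le_mul_left k (AddSubgroup.card_stableOfIndex_int_sq_le hk0)
  have h3 := Nat.mul_le_mul_right (∑ j ∈ k.divisors, ∑ i ∈ j.divisors, i) hkN
  linarith

end AffineP2m

/-! ### Summatory functions of convolutions -/

namespace ArithmeticFunction

open Finset

lemma sum_Ioc_one_div_sq_le (N : ℕ) : ∑ a ∈ Ioc 0 N, 1 / (a : ℝ) ^ 2 ≤ 2 := by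
  rcases Nat.eq_zero_or_pos N with rfl | hN
  · simp
  · have h := sum_Ioc_inv_sq_le_sub (α := ℝ) one_ne_zero hN
    rw [← Finset.sum_Ioc_consecutive _ zero_le_one hN]
    have h0 : (0 : ℝ) ≤ (N : ℝ)⁻¹ := by positivity
    have e : Ioc 0 1 = {1} := rfl
    rw [e, sum_singleton]
    simp only [one_div, Nat.cast_one, inv_one, one_pow] at h ⊢
    linarith

lemma sum_Ioc_one_div_le (x : ℝ) (hx : 1 ≤ x) :
    ∑ a ∈ Ioc 0 ⌊x⌋₊, 1 / (a : ℝ) ≤ 1 + Real.log x := by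
  have h := harmonic_le_one_add_log ⌊x⌋₊
  rw [harmonic_eq_sum_Icc] at h
  push_cast at h
  have hl : Real.log ⌊x⌋₊ ≤ Real.log x :=
    Real.log_le_log (by exact_mod_cast Nat.floor_pos.2 hx) (Nat.floor_le (by linarith))
  simp only [one_div]
  have e : Ioc 0 ⌊x⌋₊ = Icc 1 ⌊x⌋₊ := by ext; simp [Nat.succ_le_iff]
  rw [e]
  linarith

/-- Quantitative convergence of the series `∑ 1 / a ^ s` for `s ≥ 2`. -/
lemma abs_sum_Ioc_sub_le {s : ℕ} (hs : 2 ≤ s) {Z : ℝ} (hZ : HasSum (fun n : ℕ => 1 / (n : ℝ) ^ s) Z)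
    {x : ℝ} (hx : 1 ≤ x) : |∑ a ∈ Ioc 0 ⌊x⌋₊, 1 / (a : ℝ) ^ s - Z| ≤ 2 / x := by
  have hN : 0 < ⌊x⌋₊ := Nat.floor_pos.2 hx
  set N := ⌊x⌋₊
  have hs0 : s ≠ 0 := by omega
  have hlim : Filter.Tendsto (fun M : ℕ => ∑ a ∈ Ioc 0 M, 1 / (a : ℝ) ^ s) Filter.atTop (nhds Z) := by
    refine ((Filter.tendsto_add_atTop_iff_nat 1).2 hZ.tendsto_sum_nat).congr fun M => ?_
    rw [Finset.sum_range_succ']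
    -- The term n = 0 of the series is 1 / 0 = 0, so it can be dropped.
    simp only [Nat.cast_zero, ne_eq, hs0, not_false_eq_true, zero_pow, div_zero, add_zero]
    rw [Finset.range_eq_Ico, Finset.sum_Ico_add' (fun a : ℕ => 1 / (a : ℝ) ^ s) 0 M 1]
    congr 1
  have hlow : ∑ a ∈ Ioc 0 N, 1 / (a : ℝ) ^ s ≤ Z := by
    refine ge_of_tendsto hlim (Filter.eventually_atTop.2 ⟨N, fun M hM => ?_⟩)
    exact sum_le_sum_of_subset_of_nonneg (Ioc_subset_Ioc_right hM) fun _ _ _ => by positivity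
  have hup : Z ≤ ∑ a ∈ Ioc 0 N, 1 / (a : ℝ) ^ s + 1 / N := by
    refine le_of_tendsto hlim (Filter.eventually_atTop.2 ⟨N, fun M hM => ?_⟩)
    rw [← Finset.sum_Ioc_consecutive _ (Nat.zero_le N) hM]
    gcongr
    have h := sum_Ioc_inv_sq_le_sub (α := ℝ) hN.ne' hM
    have h0 : (0 : ℝ) ≤ (M : ℝ)⁻¹ := by positivity
    calc ∑ a ∈ Ioc N M, 1 / (a : ℝ) ^ s ≤ ∑ a ∈ Ioc N M, ((a : ℝ) ^ 2)⁻¹ := by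
          refine sum_le_sum fun a ha => ?_
          have ha1 : (1 : ℝ) ≤ a := by
            have := (mem_Ioc.1 ha).1
            exact_mod_cast (by omega : 1 ≤ a)
          rw [one_div]
          exact inv_anti₀ (by positivity) (pow_le_pow_right₀ ha1 hs)
      _ ≤ 1 / N := by rw [one_div]; linarith
  have hNx : 1 / (N : ℝ) ≤ 2 / x := by
    have h1 : x < N + 1 := Nat.lt_floor_add_one x
    have h2 : (1 : ℝ) ≤ N := by exact_mod_cast hN
    rw [div_le_div_iff₀ (by linarith) (by linarith)]
    linarith
  rw [abs_le]
  constructor <;> linarith [show (0 : ℝ) ≤ 2 / x by positivity]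

/-- The effect on a summatory function with main term `α x⁴` of convolution with `a ↦ a ^ i`. -/
lemma abs_sum_pow_mul_sub_le {f : ArithmeticFunction ℕ} {i s : ℕ} (hi : i ≠ 0) (hs : 2 ≤ s)
    (his : i + s = 4) {Z α C : ℝ} (hZ : HasSum (fun n : ℕ => 1 / (n : ℝ) ^ s) Z) (hα : 0 ≤ α)
    (hC : 0 ≤ C) {h : ℝ → ℝ} (hmono : ∀ y x, 1 ≤ y → y ≤ x → h y ≤ h x)
    (hf : ∀ x : ℝ, 1 ≤ x → |((∑ n ∈ Ioc 0 ⌊x⌋₊, f n : ℕ) : ℝ) - α * x ^ 4| ≤ C * x ^ 3 * h x)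
    {x : ℝ} (hx : 1 ≤ x) :
    |((∑ n ∈ Ioc 0 ⌊x⌋₊, (pow i * f) n : ℕ) : ℝ) - α * Z * x ^ 4| ≤
      2 * α * x ^ 3 + C * x ^ 3 * h x * ∑ a ∈ Ioc 0 ⌊x⌋₊, 1 / (a : ℝ) ^ (s - 1) := by
  have hx0 : 0 < x := by linarith
  -- Write the sum as Σ aⁱ F(x/a), with F the summatory function of f. The main term of F gives α x⁴
  -- Σ 1/aˢ since i - 4 = -s, and its error gives Σ 1/aˢ⁻¹.
  have e1 : ((∑ n ∈ Ioc 0 ⌊x⌋₊, (pow i * f) n : ℕ) : ℝ) - α * Z * x ^ 4 =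
      ∑ a ∈ Ioc 0 ⌊x⌋₊, (a : ℝ) ^ i *
        (((∑ n ∈ Ioc 0 ⌊x / a⌋₊, f n : ℕ) : ℝ) - α * (x / a) ^ 4) +
      α * x ^ 4 * (∑ a ∈ Ioc 0 ⌊x⌋₊, 1 / (a : ℝ) ^ s - Z) := by
    rw [sum_Ioc_mul_eq_sum_sum, mul_sub, mul_sum]
    push_cast
    rw [← add_sub_assoc, ← sum_add_distrib]
    congr 1
    · refine sum_congr rfl fun a ha => ?_
      have ha0 : (a : ℝ) ≠ 0 := by exact_mod_cast (mem_Ioc.1 ha).1.ne'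
      have hp : (a : ℝ) ^ 4 = a ^ i * a ^ s := by rw [← pow_add, his]
      rw [pow_apply, if_neg (by tauto), Nat.floor_div_natCast, div_pow, hp]
      push_cast
      field_simp
      ring
    · ring
  rw [e1]
  refine (abs_add_le _ _).trans ?_
  have h2 : |α * x ^ 4 * (∑ a ∈ Ioc 0 ⌊x⌋₊, 1 / (a : ℝ) ^ s - Z)| ≤ 2 * α * x ^ 3 := by
    rw [abs_mul, abs_of_nonneg (by positivity : 0 ≤ α * x ^ 4)]
    refine (mul_le_mul_of_nonneg_left (abs_sum_Ioc_sub_le hs hZ hx) (by positivity)).trans_eq ?_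
    field_simp
  have h1 : |∑ a ∈ Ioc 0 ⌊x⌋₊, (a : ℝ) ^ i *
        (((∑ n ∈ Ioc 0 ⌊x / a⌋₊, f n : ℕ) : ℝ) - α * (x / a) ^ 4)| ≤
      C * x ^ 3 * h x * ∑ a ∈ Ioc 0 ⌊x⌋₊, 1 / (a : ℝ) ^ (s - 1) := by
    refine (abs_sum_le_sum_abs _ _).trans ?_
    rw [mul_sum]
    refine sum_le_sum fun a ha => ?_
    have ha1 : (1 : ℝ) ≤ a := by exact_mod_cast (mem_Ioc.1 ha).1
    have hax : (a : ℝ) ≤ x := (Nat.le_floor_iff hx0.le).1 (mem_Ioc.1 ha).2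
    have hy : 1 ≤ x / a := (one_le_div (by linarith)).2 hax
    rw [abs_mul, abs_of_nonneg (by positivity : (0 : ℝ) ≤ (a : ℝ) ^ i)]
    calc (a : ℝ) ^ i * |((∑ n ∈ Ioc 0 ⌊x / a⌋₊, f n : ℕ) : ℝ) - α * (x / a) ^ 4|
        ≤ (a : ℝ) ^ i * (C * (x / a) ^ 3 * h x) := by
          refine mul_le_mul_of_nonneg_left ((hf _ hy).trans ?_) (by positivity)
          exact mul_le_mul_of_nonneg_left (hmono _ _ hy (div_le_self hx0.le ha1)) (by positivity)
      _ = C * x ^ 3 * h x * (1 / (a : ℝ) ^ (s - 1)) := by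
          have hp : (a : ℝ) ^ 3 = a ^ i * a ^ (s - 1) := by
            rw [← pow_add]; congr 1; omega
          rw [div_pow, hp]
          field_simp
  linarith

lemma abs_sum_pow_three_sub_le {x : ℝ} (hx : 1 ≤ x) :
    |((∑ n ∈ Ioc 0 ⌊x⌋₊, pow 3 n : ℕ) : ℝ) - 1 / 4 * x ^ 4| ≤ 1 * x ^ 3 * 1 := by
  have hsum : ∀ N : ℕ, ((∑ n ∈ Ioc 0 N, pow 3 n : ℕ) : ℝ) = (N * (N + 1)) ^ 2 / 4 := by
    intro N
    induction N with
    | zero => simp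
    | succ N ih =>
      rw [Finset.sum_Ioc_succ_top (Nat.zero_le N), Nat.cast_add, ih]
      simp only [pow_apply]
      push_cast
      simp
      ring
  rw [hsum]
  have h1 : (⌊x⌋₊ : ℝ) ≤ x := Nat.floor_le (by linarith)
  have h2 : x < ⌊x⌋₊ + 1 := Nat.lt_floor_add_one x
  set N : ℝ := (⌊x⌋₊ : ℝ)
  have hN : 0 ≤ N := by positivity
  have hu : N * (N + 1) ≤ x * (x + 1) := by nlinarith
  have hl : (x - 1) * x ≤ N * (N + 1) := by nlinarith
  have hu2 : (N * (N + 1)) ^ 2 ≤ (x * (x + 1)) ^ 2 := by gcongr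
  have hl2 : ((x - 1) * x) ^ 2 ≤ (N * (N + 1)) ^ 2 :=
    pow_le_pow_left₀ (mul_nonneg (by linarith) (by linarith)) hl 2
  have hx2 : x ^ 2 ≤ x ^ 3 := pow_le_pow_right₀ hx (by norm_num)
  rw [abs_le]
  constructor <;> nlinarith

/-- The logarithm arises here, from the error sum Σ 1/a; the next convolution only meets the bounded
sum Σ 1/a². -/
lemma abs_sum_pow_two_mul_pow_three_sub_le {x : ℝ} (hx : 1 ≤ x) :
    |((∑ n ∈ Ioc 0 ⌊x⌋₊, (pow 2 * pow 3) n : ℕ) : ℝ) - 1 / 4 * (Real.pi ^ 2 / 6) * x ^ 4| ≤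
      2 * x ^ 3 * (1 + Real.log x) := by
  refine (abs_sum_pow_mul_sub_le (i := 2) (s := 2) two_ne_zero le_rfl rfl hasSum_zeta_two
    (by norm_num) zero_le_one (h := fun _ => 1) (fun _ _ _ _ => le_rfl)
    (fun y hy => abs_sum_pow_three_sub_le hy) hx).trans ?_
  have h := sum_Ioc_one_div_le x hx
  have hl := Real.log_nonneg hx
  have hx3 : 0 < x ^ 3 := by positivity
  simp only [Nat.add_one_sub_one, pow_one]
  nlinarith [mul_le_mul_of_nonneg_left h hx3.le, mul_nonneg hx3.le hl]

lemma abs_sum_pow_one_mul_pow_two_mul_pow_three_sub_le {Z : ℝ}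
    (hZ : HasSum (fun n : ℕ => 1 / (n : ℝ) ^ 3) Z) {x : ℝ} (hx : 1 ≤ x) :
    |((∑ n ∈ Ioc 0 ⌊x⌋₊, (pow 1 * (pow 2 * pow 3)) n : ℕ) : ℝ) -
        1 / 4 * (Real.pi ^ 2 / 6) * Z * x ^ 4| ≤ 6 * x ^ 3 * (1 + Real.log x) := by
  refine (abs_sum_pow_mul_sub_le (i := 1) (s := 3) one_ne_zero (by norm_num) rfl hZ
    (by positivity) zero_le_two (h := fun y => 1 + Real.log y)
    (fun y z hy hyz => by gcongr)
    (fun y hy => abs_sum_pow_two_mul_pow_three_sub_le hy) hx).trans ?_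
  have h := sum_Ioc_one_div_sq_le ⌊x⌋₊
  have hl := Real.log_nonneg hx
  have hx3 : 0 < x ^ 3 := by positivity
  have hpi : Real.pi ^ 2 ≤ 16 := by nlinarith [Real.pi_pos, Real.pi_le_four]
  simp only [Nat.add_one_sub_one]
  have h1 := mul_le_mul_of_nonneg_left h (by positivity : 0 ≤ 2 * x ^ 3 * (1 + Real.log x))
  nlinarith [mul_nonneg hx3.le hl, mul_le_mul_of_nonneg_right hpi hx3.le]

/-- Convolution with `ζ` preserves quadratic bounds of summatory functions. -/
lemma sum_zeta_mul_le {f : ArithmeticFunction ℕ} {C : ℝ} (hC : 0 ≤ C)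
    (hf : ∀ N : ℕ, ((∑ n ∈ Ioc 0 N, f n : ℕ) : ℝ) ≤ C * N ^ 2) (N : ℕ) :
    ((∑ n ∈ Ioc 0 N, (zeta * f) n : ℕ) : ℝ) ≤ 2 * C * N ^ 2 := by
  rw [sum_Ioc_mul_eq_sum_sum, Nat.cast_sum]
  calc ∑ a ∈ Ioc 0 N, ((zeta a * ∑ m ∈ Ioc 0 (N / a), f m : ℕ) : ℝ)
      ≤ ∑ a ∈ Ioc 0 N, C * N ^ 2 * (1 / (a : ℝ) ^ 2) := by
        refine sum_le_sum fun a ha => ?_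
        rw [zeta_apply_ne (mem_Ioc.1 ha).1.ne', one_mul]
        refine (hf _).trans ?_
        have : ((N / a : ℕ) : ℝ) ≤ N / a := Nat.cast_div_le
        calc C * ((N / a : ℕ) : ℝ) ^ 2 ≤ C * (N / a : ℝ) ^ 2 := by gcongr
          _ = _ := by rw [div_pow]; ring
    _ = C * N ^ 2 * ∑ a ∈ Ioc 0 N, 1 / (a : ℝ) ^ 2 := by rw [mul_sum]
    _ ≤ C * N ^ 2 * 2 :=
        mul_le_mul_of_nonneg_left (sum_Ioc_one_div_sq_le N) (by positivity)
    _ = _ := by ring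

lemma zeta_mul_id_apply (j : ℕ) : (zeta * ArithmeticFunction.id) j = ∑ i ∈ j.divisors, i := by
  rw [← sigma_one_apply, ← zeta_mul_pow_eq_sigma]
  congr 2
  ext n
  simp [pow]

/-- The summand is ζ * ζ * id. The sum of id is at most N², and each convolution with ζ doubles the
constant. -/
lemma sum_Icc_sum_divisors_sum_divisors_le (N : ℕ) :
    ((∑ k ∈ Icc 1 N, ∑ j ∈ k.divisors, ∑ i ∈ j.divisors, i : ℕ) : ℝ) ≤ 4 * N ^ 2 := by
  have hid : ∀ N : ℕ, ((∑ n ∈ Ioc 0 N, ArithmeticFunction.id n : ℕ) : ℝ) ≤ 1 * N ^ 2 := by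
    intro N
    have : ∑ n ∈ Ioc 0 N, ArithmeticFunction.id n ≤ #(Ioc 0 N) • N :=
      sum_le_card_nsmul _ _ _ fun n hn => (mem_Ioc.1 hn).2
    rw [Nat.card_Ioc, Nat.sub_zero, smul_eq_mul, ← sq] at this
    rw [one_mul]
    exact_mod_cast this
  have h := sum_zeta_mul_le (by norm_num) (sum_zeta_mul_le zero_le_one hid) N
  have e : ∀ k, (zeta * (zeta * ArithmeticFunction.id)) k =
      ∑ j ∈ k.divisors, ∑ i ∈ j.divisors, i := by
    intro k
    rw [mul_apply, Nat.sum_divisorsAntidiagonal' fun a b => zeta a * (zeta * ArithmeticFunction.id) b]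
    refine sum_congr rfl fun j hj => ?_
    have hd := Nat.mem_divisors.1 hj
    rw [zeta_apply_ne, one_mul, zeta_mul_id_apply]
    exact (Nat.div_ne_zero_iff_of_dvd hd.1).2 ⟨hd.2, fun h => hd.2 (by simpa [h] using hd.1)⟩
  simp only [e] at h
  have e2 : Icc 1 N = Ioc 0 N := by ext; simp [Nat.succ_le_iff]
  rw [e2]
  linarith

/-- Multiplication by k distributes over Dirichlet convolution and raises each exponent by one;
apply this at both levels. -/
lemma pow_one_mul_pow_two_mul_pow_three_apply (k : ℕ) :
    (pow 1 * (pow 2 * pow 3)) k = k * ∑ j ∈ k.divisors, j * ∑ i ∈ j.divisors, i := by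
  rw [mul_apply, Nat.sum_divisorsAntidiagonal' fun a b => pow 1 a * (pow 2 * pow 3) b, mul_sum]
  refine sum_congr rfl fun j hj => ?_
  have hjk := Nat.div_mul_cancel (Nat.mem_divisors.1 hj).1
  have e : (pow 2 * pow 3) j = j ^ 2 * ∑ i ∈ j.divisors, i := by
    rw [mul_apply, Nat.sum_divisorsAntidiagonal' fun a b => pow 2 a * pow 3 b, mul_sum]
    refine sum_congr rfl fun i hi => ?_
    have hij := Nat.div_mul_cancel (Nat.mem_divisors.1 hi).1
    simp only [pow_apply, OfNat.ofNat_ne_zero, false_and, if_false]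
    conv_rhs => rw [← hij]
    ring
  rw [e]
  simp only [pow_apply, one_ne_zero, false_and, if_false, pow_one]
  conv_rhs => rw [← hjk]
  rw [Nat.div_mul_cancel (Nat.mem_divisors.1 hj).1]
  conv_lhs => rw [pow_two]
  generalize ∑ i ∈ j.divisors, i = t
  calc k / j * (j * j * t) = k / j * j * (j * t) := by ring
    _ = _ := by rw [hjk]

end ArithmeticFunction

/-! ### Assembling the asymptotic formula -/

lemma AffineP2m.sum_numSubgroupsOfIndex (N : ℕ) :
    ∑ n ∈ Finset.Icc 1 N, numSubgroupsOfIndex AffineP2m n =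
      ∑ k ∈ Finset.Ioc 0 (N / 2),
        (ArithmeticFunction.pow 1 * (ArithmeticFunction.pow 2 * ArithmeticFunction.pow 3)) k +
      ∑ n ∈ Finset.Icc 1 N, {H : Subgroup AffineP2m | H.index = n ∧ ¬IsCentral H}.ncard := by
  have e2 : Finset.Ioc 0 (N / 2) = Finset.Icc 1 (N / 2) := by ext; simp [Nat.succ_le_iff]
  rw [e2, Finset.sum_congr rfl fun n hn => numSubgroupsOfIndex_eq
    (Nat.one_le_iff_ne_zero.1 (Finset.mem_Icc.1 hn).1), Finset.sum_add_distrib, sum_ncard_central]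
  congr 1
  refine Finset.sum_congr rfl fun k hk => ?_
  rw [ArithmeticFunction.pow_one_mul_pow_two_mul_pow_three_apply,
    AddSubgroup.card_ofIndex_transLattice (Nat.one_le_iff_ne_zero.1 (Finset.mem_Icc.1 hk).1)]

lemma AffineP2m.abs_sum_numSubgroupsOfIndex_sub_le {Z : ℝ}
    (hZ : HasSum (fun n : ℕ => 1 / (n : ℝ) ^ 3) Z) {x : ℝ} (hx : 3 ≤ x) :
    |((∑ n ∈ Finset.Icc 1 ⌊x⌋₊, numSubgroupsOfIndex AffineP2m n : ℕ) : ℝ) -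
      Real.pi ^ 2 / 384 * Z * x ^ 4| ≤ 200 * (x ^ 3 * Real.log x) := by
  -- The main subgroups have index 2k, so k runs up to x / 2; the natural-number 2 lets the floor
  -- pass through the division.
  have h1 := ArithmeticFunction.abs_sum_pow_one_mul_pow_two_mul_pow_three_sub_le hZ
    (x := x / (2 : ℕ)) (by push_cast; linarith)
  have h2 : (((∑ n ∈ Finset.Icc 1 ⌊x⌋₊,
      {H : Subgroup AffineP2m | H.index = n ∧ ¬IsCentral H}.ncard : ℕ)) : ℝ) ≤ _ :=
    Nat.cast_le.2 (sum_ncard_noncentral_le' ⌊x⌋₊)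
  rw [Nat.cast_mul] at h2
  have h3 := ArithmeticFunction.sum_Icc_sum_divisors_sum_divisors_le ⌊x⌋₊
  rw [sum_numSubgroupsOfIndex, Nat.cast_add]
  rw [Nat.floor_div_natCast] at h1
  push_cast at h1 h2 h3 ⊢
  have hNx : (⌊x⌋₊ : ℝ) ≤ x := Nat.floor_le (by linarith)
  -- As x ≥ 3 > e, the logarithm absorbs the pure x³ terms: 164 + 2 ≤ 200.
  have hlog1 : 1 ≤ Real.log x := by
    rw [Real.le_log_iff_exp_le (by linarith)]
    linarith [Real.exp_one_lt_d9]
  have hlog2 : Real.log (x / 2) ≤ Real.log x :=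
    Real.log_le_log (by linarith) (by linarith)
  have hx3 : 0 < x ^ 3 := by positivity
  set S := ∑ n ∈ Finset.Icc 1 ⌊x⌋₊,
    ({H : Subgroup AffineP2m | H.index = n ∧ ¬IsCentral H}.ncard : ℝ) with hS
  have hS0 : 0 ≤ S := Finset.sum_nonneg fun _ _ => Nat.cast_nonneg _
  have h4 : S ≤ 164 * x ^ 3 := by
    refine h2.trans ((mul_le_mul_of_nonneg_left h3 (by positivity)).trans ?_)
    calc 41 * (⌊x⌋₊ : ℝ) * (4 * ⌊x⌋₊ ^ 2) = 164 * (⌊x⌋₊ : ℝ) ^ 3 := by ring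
      _ ≤ 164 * x ^ 3 := by gcongr
  have h5 : x ^ 3 ≤ x ^ 3 * Real.log x := le_mul_of_one_le_right hx3.le hlog1
  have h6 : 6 * (x / 2) ^ 3 * (1 + Real.log (x / 2)) ≤ 2 * (x ^ 3 * Real.log x) := by
    calc 6 * (x / 2) ^ 3 * (1 + Real.log (x / 2)) ≤ 6 * (x / 2) ^ 3 * (Real.log x + Real.log x) := by
          gcongr
      _ = 3 / 2 * (x ^ 3 * Real.log x) := by ring
      _ ≤ _ := by nlinarith
  rw [abs_le] at h1 ⊢
  have e : 1 / 4 * (Real.pi ^ 2 / 6) * Z * (x / 2) ^ 4 = Real.pi ^ 2 / 384 * Z * x ^ 4 := by ring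
  rw [e] at h1
  constructor <;> linarith [h1.1, h1.2]

theorem theorem5p1 :
    (∀ n : ℕ, 1 ≤ n → {H : Subgroup GroupP2m | H.index = n}.Finite) ∧
    Asymptotics.IsBigO Filter.atTop
      (fun x : ℝ =>
        (∑ n ∈ Finset.Icc 1 ⌊x⌋₊, (numSubgroupsOfIndex GroupP2m n : ℂ))
          - (Real.pi : ℂ) ^ 2 / 384 * riemannZeta 3 * (x : ℂ) ^ 4)
      (fun x : ℝ => x ^ 3 * Real.log x) := by
  constructor
  · intro n hn
    refine Set.Finite.of_injOn (f := Subgroup.map (AffineP2m.equivPresented : _ →* AffineP2m))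
      (fun H hH => ?_) (Subgroup.map_injective AffineP2m.equivPresented.injective).injOn
      (AffineP2m.finite_of_index (by omega : n ≠ 0))
    change (H.map _).index = n
    rw [Subgroup.index_map_equiv]
    exact hH
  · have hZ : HasSum (fun n : ℕ => 1 / (n : ℝ) ^ 3) (∑' n : ℕ, 1 / (n : ℝ) ^ 3) :=
      (Real.summable_one_div_nat_pow.2 (by norm_num)).hasSum
    have hzeta : riemannZeta 3 = ((∑' n : ℕ, 1 / (n : ℝ) ^ 3 : ℝ) : ℂ) := by
      have := zeta_nat_eq_tsum_of_gt_one (k := 3) (by norm_num)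
      push_cast at this ⊢
      exact this
    refine Asymptotics.IsBigO.of_bound 200 ?_
    filter_upwards [Filter.eventually_ge_atTop 3] with x hx
    have h := AffineP2m.abs_sum_numSubgroupsOfIndex_sub_le hZ hx
    have hlog : 0 ≤ x ^ 3 * Real.log x :=
      mul_nonneg (by positivity) (Real.log_nonneg (by linarith))
    simp only [numSubgroupsOfIndex_congr AffineP2m.equivPresented, hzeta]
    rw [Real.norm_of_nonneg hlog]
    refine le_trans (le_of_eq ?_) h
    -- The complex expression is the cast of a real one, ζ(3) being a real series.
    rw [← Real.norm_eq_abs, ← Complex.norm_real]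
    push_cast
    rfl
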